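/- Let $\mathcal O=\mathcal O_{\mathbb C^n,0}$ be the ring of convergent power series in $z=(z_1,\dots,z_n)$, and let $g_1,\dots,g_k\in\mathcal O$ be convenient (each $g_i$ contains, for every $m\in\{1,\dots,n\}$, a monomial $z_m^{a}$ with non-zero coefficient), with $g_i(0)=0$, defining a complete intersection germ in $(\mathbb C^n,0)$, i.e. $\dim \mathcal O/(g_1,\dots,g_k)=n-k$. Let $\Delta$ be the convex hull of $\operatorname{supp}(g_1\cdots g_k)+\mathbb R_+^n$, and let $p_1,\dots,p_r\in\mathbb N^n$ ($r\ge 1$) be the vectors with relatively prime components orthogonal to the compact facets of $\Delta$ (one for each compact facet). For $1\le i\le k$, $1\le l\le r$ let $\nu_{il}$ be the largest integer with $\langle p_l,q\rangle\ge\nu_{il}$ for all monomials $z^q$ occurring in $g_i$, and put $\nu_i=(\nu_{i1},\dots,\nu_{ir})$. For $\mu\in\mathbb Z^r$ let $F_\mu\subseteq\mathcal O$ be the ideal generated by all $z^q$ with $\langle p_l,q\rangle\ge\mu_l$ for $l=1,\dots,r$, and put $$\bar F_\mu:=F_\mu/(g_1F_{\mu-\nu_1}+\dots+g_kF_{\mu-\nu_k}).$$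 For $1\le j_1<\dots<j_s\le r$ and $g_i=\sum_q c_{iq}z^q$ let $in_{j_1,\dots,j_s}g_i$ be the sum of the terms $c_{iq}z^q$ with $\langle p_{j_a},q\rangle=\nu_{ij_a}$ for $a=1,\dots,s$. Assume that for all $s\ge1$ and $1\le j_1<\dots<j_s\le r$ the germs $in_{j_1,\dots,j_s}g_1,\dots,in_{j_1,\dots,j_s}g_k$ define a subspace of $(\mathbb C^n,0)$ of codimension $\ge k-s$. Then for every $\mu\in\mathbb Z^r$ the Koszul complex of $g_1,\dots,g_k$ over $\mathcal O$ induces an exact sequence $$0\to F_{\mu-\nu_1-\dots-\nu_k}\to\bigoplus_{j}F_{\mu-\nu_1-\dots-\widehat{\nu_j}-\dots-\nu_k}\to\dots\to\bigoplus_jF_{\mu-\nu_j}\to F_\mu\to\bar F_\mu\to0,$$ where the term in degree $s$ is $\bigoplus_{I\subseteq\{1,\dots,k\},\,\#I=s}F_{\mu-\sum_{i\in I}\nu_i}$. Write $\mathbf 1=(1,\dots,1)$, $t=(t_1,\dots,t_r)$, and put $$L(t)=\sum_{\mu\in\mathbb Z^r}\dim_{\mathbb C}(F_\mu/F_{\mu+\mathbf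 1})\,t^\mu,\qquad \bar L(t)=\sum_{\mu\in\mathbb Z^r}\bigl(\dim_{\mathbb C}\operatorname{coker}\phi_\mu-\dim_{\mathbb C}\ker\phi_\mu\bigr)t^\mu,$$ where $\phi_\mu:\bar F_{\mu+\mathbf 1}\to\bar F_\mu$ is the natural map (so the coefficient is the negative of the index of $\phi_\mu$). All these dimensions are finite. The Poincaré series $P_{\mathcal O_{\mathbb C^n,0}}$ and $P_{\bar F}$, i.e. the unique power series in $\mathbb Z[[t_1,\dots,t_r]]$ with $$(t_1\cdots t_r-1)P_{\mathcal O_{\mathbb C^n,0}}(t)=(t_1-1)\cdots(t_r-1)L(t),\qquad (t_1\cdots t_r-1)P_{\bar F}(t)=(t_1-1)\cdots(t_r-1)\bar L(t),$$ exist, and $$P_{\bar F}(t)=(1-t^{\nu_1})\cdots(1-t^{\nu_k})\,P_{\mathcal O_{\mathbb C^n,0}}(t),\qquad P_{\mathcal O_{\mathbb C^n,0}}(t)=\prod_{l=1}^n\frac1{1-t^{p^l}},\quad p^l=(p_{1l},\dots,p_{rl}).$$ -/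

import Mathlib

open scoped BigOperators

noncomputable section

namespace NewtonFiltration

/-! ### The local ring of convergent power series -/

/-- A formal power series in `n` variables is convergent if it converges absolutely on some
polydisc around the origin. -/
def IsConvergent {n : ℕ} (f : MvPowerSeries (Fin n) ℂ) : Prop :=
  ∃ ρ : ℝ, 0 < ρ ∧
    Summable (fun q : Fin n →₀ ℕ => ‖MvPowerSeries.coeff q f‖ * ρ ^ (Finsupp.degree q))

theorem summable_of_le {n : ℕ} {f : MvPowerSeries (Fin n) ℂ} {ρ σ : ℝ} (hσ : 0 < σ) (h : σ ≤ ρ)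
    (hf : Summable (fun q : Fin n →₀ ℕ =>
      ‖MvPowerSeries.coeff q f‖ * ρ ^ (Finsupp.degree q))) :
    Summable (fun q : Fin n →₀ ℕ => ‖MvPowerSeries.coeff q f‖ * σ ^ (Finsupp.degree q)) := by
  refine Summable.of_nonneg_of_le (fun q => by positivity) (fun q => ?_) hf
  gcongr

theorem IsConvergent.add {n : ℕ} {f g : MvPowerSeries (Fin n) ℂ} (hf : IsConvergent f)
    (hg : IsConvergent g) : IsConvergent (f + g) := by
  obtain ⟨ρ, hρ, hf⟩ := hf
  obtain ⟨σ, hσ, hg⟩ := hg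
  have hm : 0 < min ρ σ := lt_min hρ hσ
  refine ⟨min ρ σ, hm, ?_⟩
  refine Summable.of_nonneg_of_le (fun q => by positivity) (fun q => ?_)
    ((summable_of_le hm (min_le_left _ _) hf).add (summable_of_le hm (min_le_right _ _) hg))
  rw [map_add, ← add_mul]
  gcongr
  exact norm_add_le _ _

theorem IsConvergent.mul {n : ℕ} {f g : MvPowerSeries (Fin n) ℂ} (hf : IsConvergent f)
    (hg : IsConvergent g) : IsConvergent (f * g) := by
  classical
  obtain ⟨ρ, hρ, hf⟩ := hf
  obtain ⟨σ, hσ, hg⟩ := hg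
  have hm : 0 < min ρ σ := lt_min hρ hσ
  have hf' := summable_of_le hm (min_le_left _ _) hf
  have hg' := summable_of_le hm (min_le_right _ _) hg
  refine ⟨min ρ σ, hm, ?_⟩
  have hfg := hf'.mul_of_nonneg hg' (fun q => by positivity) (fun q => by positivity)
  have hs := summable_sum_mul_antidiagonal_of_summable_mul
    (f := fun q : Fin n →₀ ℕ => ‖MvPowerSeries.coeff q f‖ * min ρ σ ^ (Finsupp.degree q))
    (g := fun q : Fin n →₀ ℕ => ‖MvPowerSeries.coeff q g‖ * min ρ σ ^ (Finsupp.degree q)) hfg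
  refine Summable.of_nonneg_of_le (fun q => by positivity) (fun q => ?_) hs
  rw [MvPowerSeries.coeff_mul]
  refine (mul_le_mul_of_nonneg_right (norm_sum_le _ _) (by positivity)).trans ?_
  rw [Finset.sum_mul]
  refine Finset.sum_le_sum (fun x hx => le_of_eq ?_)
  rw [← Finset.HasAntidiagonal.mem_antidiagonal.mp hx, map_add, pow_add, norm_mul]
  ring

theorem isConvergent_monomial {n : ℕ} (q : Fin n →₀ ℕ) (c : ℂ) :
    IsConvergent (MvPowerSeries.monomial q c) := by
  classical
  refine ⟨1, one_pos, summable_of_ne_finset_zero (s := {q}) (fun m hm => ?_)⟩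
  have : m ≠ q := by simpa using hm
  simp [MvPowerSeries.coeff_monomial, this]

/-- The ring of germs at the origin of holomorphic functions on `ℂⁿ`, as the `ℂ`-algebra of
convergent power series in `n` variables. -/
def convergentSeries (n : ℕ) : Subalgebra ℂ (MvPowerSeries (Fin n) ℂ) where
  carrier := {f | IsConvergent f}
  mul_mem' := IsConvergent.mul
  add_mem' := IsConvergent.add
  algebraMap_mem' c := isConvergent_monomial 0 c

/-- The ring of germs at the origin of holomorphic functions on `ℂⁿ`. -/
def Germ (n : ℕ) : Type := convergentSeries n

instance (n : ℕ) : CommRing (Germ n) := inferInstanceAs (CommRing (convergentSeries n))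

instance (n : ℕ) : Algebra ℂ (Germ n) := inferInstanceAs (Algebra ℂ (convergentSeries n))

/-- The coefficient of `z^q` in the power series expansion of a germ. -/
def coeff {n : ℕ} (q : Fin n →₀ ℕ) (f : Germ n) : ℂ := MvPowerSeries.coeff q f.1

/-- The exponents of the monomials that occur in a germ. -/
def supp {n : ℕ} (f : Germ n) : Set (Fin n →₀ ℕ) := {q | coeff q f ≠ 0}

/-- The monomial `z^q`. -/
def zmon {n : ℕ} (q : Fin n →₀ ℕ) : Germ n :=
  ⟨MvPowerSeries.monomial q 1, isConvergent_monomial q 1⟩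

/-- `f` contains, for every coordinate, a pure power of that coordinate. -/
def IsConvenient {n : ℕ} (f : Germ n) : Prop :=
  ∀ i : Fin n, ∃ l : ℕ, Finsupp.single i l ∈ supp f

/-! ### Germs of analytic subspaces of `(ℂⁿ, 0)` -/

/-- The codimension in `(ℂⁿ, 0)` of the zero germ of `f₁, …, f_k` is at least `k - s` (an integer
that may be negative): the dimension of the germ, i.e. the Krull dimension of its local ring, is
at most `n - (k - s)`. An empty germ (zero local ring) has dimension `⊥`. -/
def CodimGE {n k : ℕ} (f : Fin k → Germ n) (s : ℕ) : Prop :=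
  ringKrullDim (Germ n ⧸ Ideal.span (Set.range f)) + (k : WithBot ℕ∞) ≤ ((n + s : ℕ) : WithBot ℕ∞)

/-- `g₁, …, g_k` define a complete intersection germ in `(ℂⁿ, 0)`: they vanish at the origin and
their zero germ has dimension `n - k`. -/
def IsCompleteIntersection {n k : ℕ} (g : Fin k → Germ n) : Prop :=
  (∀ i, coeff 0 (g i) = 0) ∧
    ringKrullDim (Germ n ⧸ Ideal.span (Set.range g)) + (k : WithBot ℕ∞) = (n : WithBot ℕ∞)

/-! ### The Newton polyhedron and the normals of its compact facets -/

/-- The Newton polyhedron of a germ: the convex hull of `supp f + ℝ₊ⁿ`. -/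
def newtonPolyhedron {n : ℕ} (f : Germ n) : Set (Fin n → ℝ) :=
  convexHull ℝ {x | ∃ q ∈ supp f, ∀ i, (q i : ℝ) ≤ x i}

/-- The subset of `Δ` on which the linear form `⟨v, ·⟩` attains its minimum over `Δ`. -/
def face {n : ℕ} (Δ : Set (Fin n → ℝ)) (v : Fin n → ℕ) : Set (Fin n → ℝ) :=
  {x ∈ Δ | ∀ y ∈ Δ, ∑ i, (v i : ℝ) * x i ≤ ∑ i, (v i : ℝ) * y i}

/-- `v ∈ ℕⁿ` has relatively prime components and is orthogonal to a compact facet of `Δ`, that is,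
a compact face of affine dimension `n - 1`. -/
def IsCompactFacetNormal {n : ℕ} (Δ : Set (Fin n → ℝ)) (v : Fin n → ℕ) : Prop :=
  Finset.univ.gcd v = 1 ∧ (face Δ v).Nonempty ∧ IsCompact (face Δ v) ∧
    Module.finrank ℝ (vectorSpan ℝ (face Δ v)) + 1 = n

/-- The pairing `⟨v, q⟩` of two vectors of `ℕⁿ`. -/
def pairing {n : ℕ} (v : Fin n → ℕ) (q : Fin n →₀ ℕ) : ℕ := ∑ i, v i * q i

/-- `order v f` is the largest `ν` with `⟨v, q⟩ ≥ ν` for all monomials `z^q` that occur in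
`f ≠ 0`. -/
def order {n : ℕ} (v : Fin n → ℕ) (f : Germ n) : ℕ := sInf (pairing v '' supp f)

/-- The vector `(order p₁ f, …, order p_r f)`. -/
def nu {n r : ℕ} (p : Fin r → Fin n → ℕ) (f : Germ n) : Fin r → ℕ := fun l => order (p l) f

/-- The initial part of `f` with respect to the weights `p_j`, `j ∈ J`: the sum of those terms
`c_q z^q` of `f` with `⟨p_j, q⟩ = order p_j f` for all `j ∈ J`. -/
def initialPart {n r : ℕ} (p : Fin r → Fin n → ℕ) (J : Finset (Fin r)) (f : Germ n) : Germ n :=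
  open Classical in
  ⟨fun q => if ∀ j ∈ J, pairing (p j) q = nu p f j then coeff q f else 0, by
    obtain ⟨ρ, hρ, hf⟩ := f.2
    refine ⟨ρ, hρ, Summable.of_nonneg_of_le (fun q => by positivity) (fun q => ?_) hf⟩
    refine mul_le_mul_of_nonneg_right ?_ (by positivity)
    change ‖if ∀ j ∈ J, pairing (p j) q = nu p f j then coeff q f else 0‖ ≤ ‖coeff q f‖
    split_ifs
    · exact le_rfl
    · simp⟩

/-! ### The multi-index filtration -/

/-- `F_μ`: the ideal generated by the monomials `z^q` with `⟨p_l, q⟩ ≥ μ_l` for all `l`. -/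
def F {n r : ℕ} (p : Fin r → Fin n → ℕ) (μ : Fin r → ℤ) : Ideal (Germ n) :=
  Ideal.span (zmon '' {q | ∀ l, μ l ≤ (pairing (p l) q : ℤ)})

theorem F_anti {n r : ℕ} (p : Fin r → Fin n → ℕ) {μ μ' : Fin r → ℤ} (h : μ ≤ μ') :
    F p μ' ≤ F p μ :=
  Ideal.span_mono (Set.image_mono fun _ hq l => (h l).trans (hq l))

/-- The multi-index `ν(f)`, viewed in `ℤ^r`. -/
def nuZ {n r : ℕ} (p : Fin r → Fin n → ℕ) (f : Germ n) : Fin r → ℤ := fun l => (nu p f l : ℤ)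

/-- The ideal `g₁ F_{μ-ν₁} + … + g_k F_{μ-ν_k}`. -/
def relIdeal {n r k : ℕ} (p : Fin r → Fin n → ℕ) (g : Fin k → Germ n) (μ : Fin r → ℤ) :
    Ideal (Germ n) :=
  ⨆ i, Ideal.span {g i} * F p (μ - nuZ p (g i))

theorem relIdeal_anti {n r k : ℕ} (p : Fin r → Fin n → ℕ) (g : Fin k → Germ n)
    {μ μ' : Fin r → ℤ} (h : μ ≤ μ') : relIdeal p g μ' ≤ relIdeal p g μ :=
  iSup_mono fun _ => Ideal.mul_mono le_rfl (F_anti p (sub_le_sub_right h _))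

/-- `F̄_μ = F_μ / (g₁ F_{μ-ν₁} + … + g_k F_{μ-ν_k})`. -/
abbrev Fbar {n r k : ℕ} (p : Fin r → Fin n → ℕ) (g : Fin k → Germ n) (μ : Fin r → ℤ) : Type :=
  F p μ ⧸ Submodule.comap (F p μ).subtype (relIdeal p g μ)

/-- The natural map `F̄_{μ+𝟏} → F̄_μ` induced by the inclusion `F_{μ+𝟏} ⊆ F_μ`. -/
def transition {n r k : ℕ} (p : Fin r → Fin n → ℕ) (g : Fin k → Germ n) (μ : Fin r → ℤ) :
    Fbar p g (μ + 1) →ₗ[Germ n] Fbar p g μ :=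
  Submodule.mapQ _ _ (Submodule.inclusion (F_anti p (le_add_of_nonneg_right zero_le_one)))
    (fun _ hx => relIdeal_anti p g (le_add_of_nonneg_right zero_le_one) hx)

/-! ### The Koszul complex -/

/-- The `s`-th term of the Koszul complex of `g₁, …, g_k`: the free module with one basis element
`e_I` for every `I ⊆ {1, …, k}` with `s` elements. -/
abbrev Koszul (n k s : ℕ) : Type := {I : Finset (Fin k) // I.card = s} → Germ n

/-- The Koszul differential, `e_{i₁} ∧ … ∧ e_{i_s} ↦ ∑ₐ (-1)^{a-1} g_{iₐ} e_{i₁} ∧ … êᵢₐ … ∧ e_{i_s}`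
for `i₁ < … < i_s`. In coordinates, the coefficient at `I` of the image of `h` is the sum over
`i ∉ I` of `(-1)^{#{j ∈ I, j < i}} g_i h_{I ∪ {i}}`. -/
def koszulD {n k : ℕ} (g : Fin k → Germ n) (s : ℕ) :
    Koszul n k (s + 1) →ₗ[Germ n] Koszul n k s :=
  LinearMap.pi fun I => ∑ i : {i : Fin k // i ∉ I.1},
    ((-1) ^ (I.1.filter (· < i.1)).card * g i.1) •
      LinearMap.proj (R := Germ n) (φ := fun _ => Germ n)
        (⟨insert i.1 I.1, by rw [Finset.card_insert_of_notMem i.2, I.2]⟩ :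
          {I : Finset (Fin k) // I.card = s + 1})

/-- The filtered piece `⨁_{#I = s} F_{μ - ∑_{i ∈ I} ν_i}` of the `s`-th term of the Koszul
complex. -/
def koszulF {n r k : ℕ} (p : Fin r → Fin n → ℕ) (g : Fin k → Germ n) (μ : Fin r → ℤ) (s : ℕ) :
    Submodule (Germ n) (Koszul n k s) :=
  Submodule.pi Set.univ fun I => F p (μ - ∑ i ∈ I.1, nuZ p (g i))

/-- The map from the term in degree `0`, which is `F_μ` (only `I = ∅` occurs), onto the
quotient `F̄_μ`. -/
def augmentation {n r k : ℕ} (p : Fin r → Fin n → ℕ) (g : Fin k → Germ n) (μ : Fin r → ℤ) :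
    koszulF p g μ 0 →ₗ[Germ n] Fbar p g μ :=
  (Submodule.mkQ _).comp
    (LinearMap.restrict
      (LinearMap.proj (R := Germ n) (φ := fun _ => Germ n)
        (⟨∅, Finset.card_empty⟩ : {I : Finset (Fin k) // I.card = 0}))
      (fun x hx => by simpa using hx ⟨∅, Finset.card_empty⟩ (Set.mem_univ _)))

/-! ### Poincaré series -/

/-- The coefficient function `μ ↦ dim F_μ / F_{μ+𝟏}` of the series `L` of the filtration on the
ring of germs. -/
def dimL {n r : ℕ} (p : Fin r → Fin n → ℕ) (μ : Fin r → ℤ) : ℤ :=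
  (Module.finrank ℂ (F p μ ⧸ Submodule.comap (F p μ).subtype (F p (μ + 1))) : ℤ)

/-- The coefficient function of the series `L` of `F̄`: the negative of the index of
`F̄_{μ+𝟏} → F̄_μ`, i.e. the dimension of the cokernel minus the dimension of the kernel. -/
def dimLbar {n r k : ℕ} (p : Fin r → Fin n → ℕ) (g : Fin k → Germ n) (μ : Fin r → ℤ) : ℤ :=
  (Module.finrank ℂ (Fbar p g μ ⧸ LinearMap.range (transition p g μ)) : ℤ) -
    (Module.finrank ℂ (LinearMap.ker (transition p g μ)) : ℤ)

/-- The monomial `t^m` in `ℤ⟦t₁, …, t_r⟧`. -/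
def tpow {r : ℕ} (m : Fin r → ℕ) : MvPowerSeries (Fin r) ℤ :=
  MvPowerSeries.monomial (Finsupp.equivFunOnFinite.symm m) 1

/-- The coefficient of `t^μ`, `μ ∈ ℤ^r`, of a power series regarded as a series with exponents
in `ℤ^r`. -/
def coeffZ {r : ℕ} (P : MvPowerSeries (Fin r) ℤ) (μ : Fin r → ℤ) : ℤ :=
  open Classical in
  if 0 ≤ μ then MvPowerSeries.coeff (Finsupp.equivFunOnFinite.symm fun l => (μ l).toNat) P else 0

/-- The coefficient of `t^μ` in the product of `(t₁ - 1) ⋯ (t_r - 1) = ∑_S (-1)^{r - #S} ∏_{l ∈ S} t_l`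
with the (in general two-sided infinite) series `∑_μ L(μ) t^μ`. -/
def numeratorCoeff {r : ℕ} (L : (Fin r → ℤ) → ℤ) (μ : Fin r → ℤ) : ℤ :=
  ∑ S : Finset (Fin r), (-1) ^ (r - S.card) * L (μ - fun l => if l ∈ S then 1 else 0)

/-- The power series `P` is
`(t₁ - 1) ⋯ (t_r - 1) / (t₁ ⋯ t_r - 1) · L(t)` for the series `L(t) = ∑_μ L(μ) t^μ`, that is,
`(t₁ ⋯ t_r - 1) P(t) = (t₁ - 1) ⋯ (t_r - 1) L(t)`. -/
def IsPoincareSeries {r : ℕ} (L : (Fin r → ℤ) → ℤ) (P : MvPowerSeries (Fin r) ℤ) : Prop :=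
  ∀ μ : Fin r → ℤ, coeffZ ((tpow 1 - 1) * P) μ = numeratorCoeff L μ

end NewtonFiltration

end

/-! The heart of the matter is that the Koszul complex stays exact on the filtered pieces; the rest
is counting lattice points. Exactness rests on two facts.

Depth. If the zero germ of f_1, …, f_k has codimension at least k - c, its Koszul homology vanishes
in degrees above c (`koszulExact_of_codimGE`). For a proper ideal, at most n + c - k elements of the
maximal ideal can be added until the enlarged ideal contains z_1^N, …, z_n^N. This is a weakly
regular sequence of length n, so the homology of the longer complex vanishes above degree c, and
Nakayama's lemma removes the added elements one by one. The ring theory needed (the ring is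
Noetherian and local, monomial ideals are recognised on supports) comes from a single convergent
division theorem, `exists_division`, for the order of monomials by ∏ prime_i^{q_i}.

Filtration. For a set J of weights, take the Koszul complex of the initial parts in_J g_i on the
terms homogeneous for J and bounded below in all weights. It is exact in degrees above #J
(`koszulLevelExact`), by descending induction on #J. The depth statement yields a primitive y of a
cycle x, possibly of too small order in some weight l outside J. The part of y of lowest admissible
l-weight is then a cycle for J ∪ {l}, hence a boundary by induction, and subtracting a boundary from
y raises its order (`exists_primitive_raise`). Finitely many such corrections suffice. The case J =
∅ is the exact sequence of the theorem; its codimension bound is the complete intersection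
hypothesis.

Counting. Compactness of the facets makes the normals positive, so F_μ/F_{μ+𝟏} has a finite basis of
monomials. Comparing the exact sequences for μ and μ + 𝟏 gives L̄ = ∏ (1 - t^{ν_i}) · L
(`dimLbar_eq_sum`). Inclusion-exclusion gives ∏ (t_l - 1) · L = (t_1 ⋯ t_r - 1) ∑_q t^{⟨p,q⟩}
(`numeratorCoeff_dimL`), and the last sum is a product of geometric series. -/

noncomputable section

namespace NewtonFiltration

section

variable {n : ℕ}

/-! ### Coefficients of germs -/

/-- The coefficient of `z^q` as a linear functional. -/
def coeffL (q : Fin n →₀ ℕ) : Germ n →ₗ[ℂ] ℂ where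
  toFun := coeff q
  map_add' _ _ := rfl
  map_smul' _ _ := rfl

theorem Germ.ext {f g : Germ n} (h : ∀ q, coeff q f = coeff q g) : f = g :=
  Subtype.ext (MvPowerSeries.ext h)

@[simp] theorem coeff_add (q : Fin n →₀ ℕ) (f g : Germ n) :
    coeff q (f + g) = coeff q f + coeff q g := rfl

@[simp] theorem coeff_sub (q : Fin n →₀ ℕ) (f g : Germ n) :
    coeff q (f - g) = coeff q f - coeff q g := (coeffL q).map_sub f g

@[simp] theorem coeff_neg (q : Fin n →₀ ℕ) (f : Germ n) : coeff q (-f) = -coeff q f := rfl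

@[simp] theorem coeff_zero (q : Fin n →₀ ℕ) : coeff q (0 : Germ n) = 0 := rfl

@[simp] theorem coeff_smul (q : Fin n →₀ ℕ) (c : ℂ) (f : Germ n) :
    coeff q (c • f) = c * coeff q f := rfl

theorem coeff_sum {ι : Type*} (s : Finset ι) (q : Fin n →₀ ℕ) (f : ι → Germ n) :
    coeff q (∑ i ∈ s, f i) = ∑ i ∈ s, coeff q (f i) := map_sum (coeffL q) f s

theorem coeff_mul (q : Fin n →₀ ℕ) (f g : Germ n) :
    coeff q (f * g) = ∑ x ∈ Finset.HasAntidiagonal.antidiagonal q, coeff x.1 f * coeff x.2 g :=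
  MvPowerSeries.coeff_mul q f.1 g.1

open Classical in
theorem coeff_zmon (q m : Fin n →₀ ℕ) : coeff q (zmon m) = if q = m then 1 else 0 :=
  MvPowerSeries.coeff_monomial q m 1

open Classical in
theorem coeff_one (q : Fin n →₀ ℕ) : coeff q (1 : Germ n) = if q = 0 then 1 else 0 :=
  MvPowerSeries.coeff_one q

theorem zmon_zero : zmon (0 : Fin n →₀ ℕ) = 1 := rfl

open Classical in
theorem coeff_mul_zmon (q m : Fin n →₀ ℕ) (f : Germ n) :
    coeff q (f * zmon m) = if m ≤ q then coeff (q - m) f else 0 := by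
  have := MvPowerSeries.coeff_mul_monomial q m f.1 (1 : ℂ)
  rw [mul_one] at this
  exact this

theorem zmon_mul (a b : Fin n →₀ ℕ) : zmon a * zmon b = zmon (a + b) := by
  have := MvPowerSeries.monomial_mul_monomial a b (1 : ℂ) (1 : ℂ)
  rw [mul_one] at this
  exact Subtype.ext this

theorem zmon_pow (a : Fin n →₀ ℕ) (N : ℕ) : zmon a ^ N = zmon (N • a) := by
  induction N with
  | zero => simp [zmon_zero]
  | succ N ih => rw [pow_succ, ih, zmon_mul, succ_nsmul]

theorem mem_supp {f : Germ n} {q : Fin n →₀ ℕ} : q ∈ supp f ↔ coeff q f ≠ 0 := Iff.rfl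

theorem supp_subset_iff {f : Germ n} {S : Set (Fin n →₀ ℕ)} :
    supp f ⊆ S ↔ ∀ q, q ∉ S → coeff q f = 0 :=
  forall_congr' fun _ => not_imp_comm

theorem eq_zero_of_supp_subset_empty {f : Germ n} (h : ∀ q, q ∉ supp f) : f = 0 :=
  Germ.ext fun q => not_not.1 (h q)

/-! ### A multiplicative weight on monomials -/

/-- The product of the first `n` primes with exponents `q`. It is injective and turns sums of
exponents into products. -/
def primeWeight (q : Fin n →₀ ℕ) : ℕ := ∏ i : Fin n, Nat.nth Nat.Prime i ^ q i

theorem primeWeight_add (a b : Fin n →₀ ℕ) :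
    primeWeight (a + b) = primeWeight a * primeWeight b := by
  simp [primeWeight, pow_add, Finset.prod_mul_distrib]

theorem primeWeight_pos (q : Fin n →₀ ℕ) : 0 < primeWeight q :=
  Finset.prod_pos fun i _ => pow_pos (Nat.prime_nth_prime i).pos _

/-- The exponents are the multiplicities of the primes in the product. Injectivity makes the order
by weight total, with finitely many exponents below any given one. -/
theorem primeWeight_injective : Function.Injective (primeWeight (n := n)) := by
  intro a b h
  ext i
  have key (c : Fin n →₀ ℕ) : (primeWeight c).factorization (Nat.nth Nat.Prime i) = c i := by
    unfold primeWeight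
    rw [Nat.factorization_prod (g := fun j : Fin n => Nat.nth Nat.Prime j ^ c j)
      (fun j _ => (pow_pos (Nat.prime_nth_prime j).pos _).ne'), Finset.sum_apply']
    rw [Finset.sum_eq_single i]
    · simp [(Nat.prime_nth_prime i).factorization_pow]
    · intro j _ hj
      rw [(Nat.prime_nth_prime j).factorization_pow, Finsupp.single_apply, if_neg]
      intro h
      exact hj (Fin.ext (Nat.nth_injective Nat.infinite_setOfPred_prime h))
    · simp
  rw [← key a, ← key b, h]

theorem finite_primeWeight_lt (M : ℕ) : {q : Fin n →₀ ℕ | primeWeight q < M}.Finite :=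
  Set.Finite.preimage primeWeight_injective.injOn (Set.finite_lt_nat M)

theorem two_pow_degree_le_primeWeight (q : Fin n →₀ ℕ) : 2 ^ q.degree ≤ primeWeight q := by
  rw [Finsupp.degree_eq_sum, ← Finset.prod_pow_eq_pow_sum]
  exact Finset.prod_le_prod' fun i _ => Nat.pow_le_pow_left (Nat.prime_nth_prime i).two_le _

theorem primeWeight_le_pow_degree (q : Fin n →₀ ℕ) :
    primeWeight q ≤ Nat.nth Nat.Prime n ^ q.degree := by
  rw [Finsupp.degree_eq_sum, ← Finset.prod_pow_eq_pow_sum]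
  refine Finset.prod_le_prod' fun i _ => Nat.pow_le_pow_left ?_ _
  exact (Nat.nth_strictMono Nat.infinite_setOfPred_prime).monotone i.2.le

/-- The real weight `primeWeight q ^ (-σ)`. -/
def wt (σ : ℕ) (q : Fin n →₀ ℕ) : ℝ := ((primeWeight q : ℝ) ^ σ)⁻¹

theorem wt_pos (σ : ℕ) (q : Fin n →₀ ℕ) : 0 < wt σ q :=
  inv_pos.2 (pow_pos (Nat.cast_pos.2 (primeWeight_pos q)) _)

theorem wt_add (σ : ℕ) (a b : Fin n →₀ ℕ) : wt σ (a + b) = wt σ a * wt σ b := by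
  simp [wt, primeWeight_add, mul_pow, mul_comm]

theorem wt_exponent_add (σ τ : ℕ) (a : Fin n →₀ ℕ) : wt (σ + τ) a = wt σ a * wt τ a := by
  simp [wt, pow_add, mul_comm]

theorem wt_anti {σ τ : ℕ} (h : σ ≤ τ) (q : Fin n →₀ ℕ) : wt τ q ≤ wt σ q := by
  have h1 : (1 : ℝ) ≤ primeWeight q := Nat.one_le_cast.2 (primeWeight_pos q)
  unfold wt
  gcongr

theorem summable_wt_of_le {c : (Fin n →₀ ℕ) → ℂ} {σ τ : ℕ} (h : σ ≤ τ)
    (hc : Summable fun q => ‖c q‖ * wt σ q) : Summable fun q => ‖c q‖ * wt τ q :=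
  Summable.of_nonneg_of_le (fun _ => mul_nonneg (norm_nonneg _) (wt_pos _ _).le)
    (fun q => mul_le_mul_of_nonneg_left (wt_anti h q) (norm_nonneg _)) hc

/-- `wt σ` is evaluation on the polydisc with radii prime_i^{-σ}. These polydiscs shrink to the
origin and are comparable to those of equal radii, because 2^{|q|} ≤ `primeWeight q` ≤ P^{|q|} for a
fixed prime P. -/
theorem isConvergent_iff_wt (f : MvPowerSeries (Fin n) ℂ) :
    IsConvergent f ↔ ∃ σ : ℕ, Summable fun q => ‖MvPowerSeries.coeff q f‖ * wt σ q := by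
  constructor
  · rintro ⟨ρ, hρ, hf⟩
    obtain ⟨σ, hσ⟩ := exists_pow_lt_of_lt_one hρ (by norm_num : (1 / 2 : ℝ) < 1)
    refine ⟨σ, Summable.of_nonneg_of_le (fun q => mul_nonneg (norm_nonneg _) (wt_pos _ _).le)
      (fun q => mul_le_mul_of_nonneg_left ?_ (norm_nonneg _)) hf⟩
    calc wt σ q ≤ (((2 : ℝ) ^ q.degree) ^ σ)⁻¹ := by
          unfold wt
          gcongr
          exact_mod_cast two_pow_degree_le_primeWeight q
      _ = ((1 / 2) ^ σ) ^ q.degree := by rw [← pow_mul, mul_comm, pow_mul]; simp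
      _ ≤ ρ ^ q.degree := by gcongr
  · rintro ⟨σ, hf⟩
    have hP : (0 : ℝ) < Nat.nth Nat.Prime n := Nat.cast_pos.2 (Nat.prime_nth_prime n).pos
    refine ⟨((Nat.nth Nat.Prime n : ℝ) ^ σ)⁻¹, by positivity,
      Summable.of_nonneg_of_le (fun q => by positivity)
      (fun q => mul_le_mul_of_nonneg_left ?_ (norm_nonneg _)) hf⟩
    have h0 : (0 : ℝ) < primeWeight q := Nat.cast_pos.2 (primeWeight_pos q)
    rw [inv_pow, ← pow_mul, mul_comm, pow_mul, wt]
    gcongr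
    exact_mod_cast primeWeight_le_pow_degree q

/-- The germ with given coefficients that are summable for some weight. -/
def ofCoeff (c : (Fin n →₀ ℕ) → ℂ) (h : ∃ σ : ℕ, Summable fun q => ‖c q‖ * wt σ q) : Germ n :=
  ⟨c, (isConvergent_iff_wt c).2 h⟩

@[simp] theorem coeff_ofCoeff (c : (Fin n →₀ ℕ) → ℂ)
    (h : ∃ σ : ℕ, Summable fun q => ‖c q‖ * wt σ q) (q : Fin n →₀ ℕ) :
    coeff q (ofCoeff c h) = c q := rfl

theorem exists_summable_wt (f : Germ n) : ∃ σ : ℕ, Summable fun q => ‖coeff q f‖ * wt σ q :=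
  (isConvergent_iff_wt f.1).1 f.2

/-! ### Truncation of a germ to a set of exponents -/

/-- The sum of the terms of `f` with exponents in `S`. -/
def res (S : Set (Fin n →₀ ℕ)) : Germ n →ₗ[ℂ] Germ n := open Classical in {
  toFun f := ofCoeff (fun q => if q ∈ S then coeff q f else 0) (by
    obtain ⟨σ, h⟩ := exists_summable_wt f
    refine ⟨σ, Summable.of_nonneg_of_le (fun q => mul_nonneg (norm_nonneg _) (wt_pos _ _).le)
      (fun q => mul_le_mul_of_nonneg_right ?_ (wt_pos _ _).le) h⟩
    split_ifs <;> simp)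
  map_add' f g := Germ.ext fun q => by simp; split_ifs <;> simp
  map_smul' c f := Germ.ext fun q => by simp }

open Classical in
theorem coeff_res (S : Set (Fin n →₀ ℕ)) (f : Germ n) (q : Fin n →₀ ℕ) :
    coeff q (res S f) = if q ∈ S then coeff q f else 0 := rfl

theorem supp_res_subset (S : Set (Fin n →₀ ℕ)) (f : Germ n) : supp (res S f) ⊆ S := by
  classical
  intro q hq
  by_contra h
  exact hq (by rw [coeff_res, if_neg h])

theorem supp_res_subset_supp (S : Set (Fin n →₀ ℕ)) (f : Germ n) : supp (res S f) ⊆ supp f := by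
  classical
  intro q hq h
  exact hq (by rw [coeff_res, h, ite_self])

theorem res_eq_self {S : Set (Fin n →₀ ℕ)} {f : Germ n} (h : supp f ⊆ S) : res S f = f := by
  classical
  refine Germ.ext fun q => ?_
  rw [coeff_res]
  split_ifs with hq
  · rfl
  · exact (supp_subset_iff.1 h q hq).symm

theorem res_eq_zero {S : Set (Fin n →₀ ℕ)} {f : Germ n} (h : ∀ q ∈ supp f, q ∉ S) :
    res S f = 0 := by
  classical
  refine Germ.ext fun q => ?_
  rw [coeff_res]
  split_ifs with hq
  · by_contra hne
    exact h q hne hq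
  · rfl

/-- Truncation is not multiplicative in general. It is when membership of a product exponent in `C`
is decided factor by factor, as for parts of lowest weight. -/
theorem res_mul {A B C : Set (Fin n →₀ ℕ)} {f g : Germ n}
    (h : ∀ a ∈ supp f, ∀ b ∈ supp g, a + b ∈ C ↔ a ∈ A ∧ b ∈ B) :
    res C (f * g) = res A f * res B g := by
  classical
  refine Germ.ext fun q => ?_
  have key : ∀ x ∈ Finset.HasAntidiagonal.antidiagonal q, coeff x.1 (res A f) * coeff x.2 (res B g) =
      if q ∈ C then coeff x.1 f * coeff x.2 g else 0 := by
    intro x hx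
    have hx := Finset.HasAntidiagonal.mem_antidiagonal.1 hx
    by_cases h1 : coeff x.1 f = 0
    · simp [coeff_res, h1]
    by_cases h2 : coeff x.2 g = 0
    · simp [coeff_res, h2]
    have := h _ h1 _ h2
    rw [hx] at this
    by_cases hq : q ∈ C
    · simp [coeff_res, hq, this.1 hq]
    · have h3 := mt this.2 hq
      rw [not_and_or] at h3
      rcases h3 with h3 | h3 <;> simp [coeff_res, hq, h3]
  rw [coeff_res, coeff_mul, coeff_mul, Finset.sum_congr rfl key]
  split_ifs <;> simp

theorem supp_mul_subset {A B C : Set (Fin n →₀ ℕ)} {f g : Germ n} (hf : supp f ⊆ A)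
    (hg : supp g ⊆ B) (h : ∀ a ∈ A, ∀ b ∈ B, a + b ∈ C) : supp (f * g) ⊆ C := by
  rw [← res_eq_self hf, ← res_eq_self hg,
    ← res_mul (C := C) (fun a ha b hb => iff_of_true (h a (hf ha) b (hg hb)) ⟨hf ha, hg hb⟩)]
  exact supp_res_subset _ _

theorem supp_add_subset {S : Set (Fin n →₀ ℕ)} {f g : Germ n} (hf : supp f ⊆ S)
    (hg : supp g ⊆ S) : supp (f + g) ⊆ S := by
  rw [supp_subset_iff] at *
  intro q hq
  simp [hf q hq, hg q hq]

theorem supp_neg (f : Germ n) : supp (-f) = supp f := by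
  ext q
  simp [mem_supp]

theorem supp_zero_subset (S : Set (Fin n →₀ ℕ)) : supp (0 : Germ n) ⊆ S := fun _ hq =>
  absurd rfl hq

/-- The germs with exponents in `S`. -/
def suppIn (S : Set (Fin n →₀ ℕ)) : Submodule ℂ (Germ n) where
  carrier := {f | supp f ⊆ S}
  add_mem' := supp_add_subset
  zero_mem' := supp_zero_subset S
  smul_mem' c f hf := supp_subset_iff.2 fun q hq => by
    simp [supp_subset_iff.1 hf q hq]

theorem mem_suppIn {S : Set (Fin n →₀ ℕ)} {f : Germ n} : f ∈ suppIn S ↔ supp f ⊆ S := Iff.rfl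

end

section

variable {n : ℕ}

/-! ### Division with remainder -/

/-- On a small enough polydisc the leading term dominates the whole tail. The factor 1/2 is the
contraction constant used in `triangularSolve_summable`. -/
theorem tail_estimate (f : Germ n) (a : Fin n →₀ ℕ)
    (hf : ∀ q ∈ supp f, q ≠ a → primeWeight a < primeWeight q) :
    ∃ σ₀ : ℕ, ∀ σ, σ₀ ≤ σ → ∀ s : Finset (Fin n →₀ ℕ), a ∉ s →
      ∑ q ∈ s, ‖coeff q f‖ * wt σ q ≤ 1 / 2 * wt σ a := by
  obtain ⟨σ₁, h₁⟩ := exists_summable_wt f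
  set C := ∑' q, ‖coeff q f‖ * wt σ₁ q
  have hterm : ∀ q, 0 ≤ ‖coeff q f‖ * wt σ₁ q := fun q =>
    mul_nonneg (norm_nonneg _) (wt_pos _ _).le
  have hC : 0 ≤ C := tsum_nonneg hterm
  have hNa : (0 : ℝ) < primeWeight a := Nat.cast_pos.2 (primeWeight_pos a)
  -- Every other exponent of `f` has integer weight at least `primeWeight a + 1`, so raising σ by τ
  -- shrinks its term, relative to that of `a`, by at least ρ^τ.
  set ρ : ℝ := primeWeight a / (primeWeight a + 1)
  have hρ0 : 0 ≤ ρ := by positivity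
  have hρ1 : ρ < 1 := (div_lt_one (by positivity)).2 (lt_add_one _)
  have hε : 0 < 1 / 2 * wt σ₁ a / (C + 1) := by have := wt_pos σ₁ a; positivity
  obtain ⟨τ₀, hτ₀⟩ := exists_pow_lt_of_lt_one hε hρ1
  refine ⟨σ₁ + τ₀, fun σ hσ s hs => ?_⟩
  obtain ⟨τ, rfl⟩ : ∃ τ, σ = σ₁ + τ := ⟨σ - σ₁, by omega⟩
  have hτ : τ₀ ≤ τ := by omega
  set B : ℝ := (((primeWeight a : ℝ) + 1) ^ τ)⁻¹
  have hB : 0 ≤ B := by positivity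
  calc ∑ q ∈ s, ‖coeff q f‖ * wt (σ₁ + τ) q
      ≤ ∑ q ∈ s, ‖coeff q f‖ * wt σ₁ q * B := by
        refine Finset.sum_le_sum fun q hq => ?_
        by_cases h0 : coeff q f = 0
        · simp [h0]
        have hlt := hf q h0 (fun h => hs (h ▸ hq))
        rw [wt_exponent_add, ← mul_assoc]
        refine mul_le_mul_of_nonneg_left ?_ (hterm q)
        have : (primeWeight a : ℝ) + 1 ≤ primeWeight q := by exact_mod_cast hlt
        unfold wt B
        gcongr
    _ = (∑ q ∈ s, ‖coeff q f‖ * wt σ₁ q) * B := by rw [Finset.sum_mul]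
    _ ≤ (C + 1) * B := by
        gcongr
        exact (h₁.sum_le_tsum s fun q _ => hterm q).trans (le_add_of_nonneg_right zero_le_one)
    _ = (C + 1) * ρ ^ τ * wt τ a := by
        unfold B ρ wt
        rw [div_pow]
        field_simp
    _ ≤ (C + 1) * (1 / 2 * wt σ₁ a / (C + 1)) * wt τ a := by
        have := (wt_pos τ a).le
        gcongr
        exact (pow_le_pow_of_le_one hρ0 hρ1.le hτ).trans hτ₀.le
    _ = 1 / 2 * wt (σ₁ + τ) a := by
        rw [wt_exponent_add]
        field_simp

/-- The solution of the triangular system `g q = ∑ x q' * u q' q`. -/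
def triangularSolve (g : (Fin n →₀ ℕ) → ℂ) (u : (Fin n →₀ ℕ) → (Fin n →₀ ℕ) → ℂ)
    (q : Fin n →₀ ℕ) : ℂ :=
  g q - ∑ q' ∈ (finite_primeWeight_lt (primeWeight q)).toFinset.attach,
    triangularSolve g u q'.1 * u q'.1 q
termination_by primeWeight q
decreasing_by exact (finite_primeWeight_lt (primeWeight q)).mem_toFinset.1 q'.2

theorem triangularSolve_eq (g : (Fin n →₀ ℕ) → ℂ) (u : (Fin n →₀ ℕ) → (Fin n →₀ ℕ) → ℂ)
    (q : Fin n →₀ ℕ) : triangularSolve g u q =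
      g q - ∑ q' ∈ (finite_primeWeight_lt (primeWeight q)).toFinset,
        triangularSolve g u q' * u q' q := by
  rw [triangularSolve, Finset.sum_attach _ fun q' => triangularSolve g u q' * u q' q]

theorem triangularSolve_sum {g : (Fin n →₀ ℕ) → ℂ} {u : (Fin n →₀ ℕ) → (Fin n →₀ ℕ) → ℂ}
    (hu1 : ∀ q, u q q = 1) (hu : ∀ q q', u q q' ≠ 0 → q' = q ∨ primeWeight q < primeWeight q')
    (q : Fin n →₀ ℕ) (D : Finset (Fin n →₀ ℕ)) (hD : ∀ q', primeWeight q' ≤ primeWeight q → q' ∈ D) :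
    ∑ q' ∈ D, triangularSolve g u q' * u q' q = g q := by
  classical
  set L := (finite_primeWeight_lt (primeWeight q)).toFinset
  have hL : ∀ q', q' ∈ L ↔ primeWeight q' < primeWeight q := fun q' => by simp [L]
  have hqL : q ∉ L := fun h => lt_irrefl _ ((hL q).1 h)
  rw [← Finset.sum_subset (s₁ := insert q L), Finset.sum_insert hqL, hu1, mul_one,
    triangularSolve_eq, sub_add_cancel]
  · intro q' hq'
    rcases Finset.mem_insert.1 hq' with rfl | h
    · exact hD _ le_rfl
    · exact hD _ ((hL q').1 h).le
  · intro q' _ hq'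
    rw [Finset.mem_insert, not_or, hL] at hq'
    by_contra h
    rcases hu q' q (right_ne_zero_of_mul h) with h | h
    · exact hq'.1 h.symm
    · exact hq'.2 h

/-- Let S be the weighted norm of the solution over the exponents of weight below M. The recursion
and the bound on the off-diagonal entries give S ≤ C + S/2, so S ≤ 2C independently of M. -/
theorem triangularSolve_summable {g : (Fin n →₀ ℕ) → ℂ} {u : (Fin n →₀ ℕ) → (Fin n →₀ ℕ) → ℂ}
    {σ : ℕ} (hg : Summable fun q => ‖g q‖ * wt σ q)
    (hus : ∀ q, ∀ s : Finset (Fin n →₀ ℕ), q ∉ s →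
      ∑ q' ∈ s, ‖u q q'‖ * wt σ q' ≤ 1 / 2 * wt σ q) :
    Summable fun q => ‖triangularSolve g u q‖ * wt σ q := by
  classical
  set x := triangularSolve g u
  set C := ∑' q, ‖g q‖ * wt σ q
  have hbound : ∀ M : ℕ, ∑ q ∈ (finite_primeWeight_lt (n := n) M).toFinset, ‖x q‖ * wt σ q
      ≤ 2 * C := by
    intro M
    set D := (finite_primeWeight_lt (n := n) M).toFinset
    have hD : ∀ q, q ∈ D ↔ primeWeight q < M := fun q => by simp [D]
    have h1 : ∑ q ∈ D, ‖x q‖ * wt σ q ≤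
        ∑ q ∈ D, (‖g q‖ * wt σ q + ∑ q' ∈ D, if primeWeight q' < primeWeight q then
          ‖x q'‖ * ‖u q' q‖ * wt σ q else 0) := by
      refine Finset.sum_le_sum fun q hq => ?_
      rw [← Finset.sum_filter]
      have h2 : ‖x q‖ ≤ ‖g q‖ + ∑ q' ∈ D with primeWeight q' < primeWeight q,
          ‖x q'‖ * ‖u q' q‖ := by
        have : D.filter (fun q' => primeWeight q' < primeWeight q) =
            (finite_primeWeight_lt (primeWeight q)).toFinset := by
          ext q'
          simp only [Finset.mem_filter, hD, Set.Finite.mem_toFinset, Set.mem_ofPred_eq]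
          exact ⟨fun h => h.2, fun h => ⟨h.trans ((hD q).1 hq), h⟩⟩
        rw [this, show x q = _ from triangularSolve_eq g u q]
        refine (norm_sub_le _ _).trans (add_le_add le_rfl ((norm_sum_le _ _).trans ?_))
        exact Finset.sum_le_sum fun q' _ => (norm_mul _ _).le
      calc ‖x q‖ * wt σ q ≤ _ := mul_le_mul_of_nonneg_right h2 (wt_pos _ _).le
        _ = _ := by rw [add_mul, Finset.sum_mul]
    have h3 : ∑ q ∈ D, ∑ q' ∈ D, (if primeWeight q' < primeWeight q then
          ‖x q'‖ * ‖u q' q‖ * wt σ q else 0) ≤ ∑ q' ∈ D, ‖x q'‖ * (1 / 2 * wt σ q') := by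
      rw [Finset.sum_comm]
      refine Finset.sum_le_sum fun q' _ => ?_
      rw [← Finset.sum_filter]
      simp_rw [mul_assoc]
      rw [← Finset.mul_sum]
      refine mul_le_mul_of_nonneg_left (hus q' _ ?_) (norm_nonneg _)
      simp
    have h4 : ∑ q ∈ D, ‖g q‖ * wt σ q ≤ C :=
      hg.sum_le_tsum D fun q _ => mul_nonneg (norm_nonneg _) (wt_pos _ _).le
    have h5 : ∑ q' ∈ D, ‖x q'‖ * (1 / 2 * wt σ q') = 1 / 2 * ∑ q ∈ D, ‖x q‖ * wt σ q := by
      rw [Finset.mul_sum]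
      exact Finset.sum_congr rfl fun q _ => by ring
    rw [Finset.sum_add_distrib] at h1
    linarith
  refine summable_of_sum_le (c := 2 * C) (fun q => mul_nonneg (norm_nonneg _) (wt_pos _ _).le)
    fun s => ?_
  refine le_trans (Finset.sum_le_sum_of_subset_of_nonneg ?_ fun q _ _ =>
    mul_nonneg (norm_nonneg _) (wt_pos _ _).le) (hbound (s.sup primeWeight + 1))
  intro q hq
  simpa [Nat.lt_succ_iff] using Finset.le_sup (f := primeWeight) hq

/-- Division of a germ by a finite family of germs with leading exponents `a i`. -/
theorem exists_division {ι : Type*} [Fintype ι] (a : ι → Fin n →₀ ℕ) (f : ι → Germ n)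
    (hf1 : ∀ i, coeff (a i) (f i) = 1)
    (hf : ∀ i, ∀ q ∈ supp (f i), q ≠ a i → primeWeight (a i) < primeWeight q) (g : Germ n) :
    ∃ (Q : ι → Germ n) (R : Germ n), g = ∑ i, Q i * f i + R ∧ ∀ q ∈ supp R, ∀ i, ¬ a i ≤ q := by
  classical
  choose σf hσf using fun i => tail_estimate (f i) (a i) (hf i)
  obtain ⟨σg, hσg⟩ := exists_summable_wt g
  -- One polydisc that serves the dividend and all divisors.
  set σ := σg + ∑ i, σf i
  have hσi : ∀ i, σf i ≤ σ := fun i =>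
    (Finset.single_le_sum (fun _ _ => Nat.zero_le _) (Finset.mem_univ i)).trans
      (Nat.le_add_left _ _)
  have hg := summable_wt_of_le (τ := σ) (Nat.le_add_right _ _) hσg
  -- Each exponent divisible by some leading exponent is assigned to one such divisor; the others
  -- belong to the remainder.
  let c : (Fin n →₀ ℕ) → Option ι := fun q =>
    if h : ∃ i, a i ≤ q then some h.choose else none
  have hc_some : ∀ {q i}, c q = some i → a i ≤ q := by
    intro q i h
    by_cases hq : ∃ i, a i ≤ q
    · simp only [c, dif_pos hq, Option.some.injEq] at h
      exact h ▸ hq.choose_spec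
    · simp [c, dif_neg hq] at h
  have hc_none : ∀ {q}, c q = none → ∀ i, ¬ a i ≤ q := by
    intro q h i hi
    have hq : ∃ i, a i ≤ q := ⟨i, hi⟩
    simp [c, dif_pos hq] at h
  -- Row `q` lists the coefficients of z^{q - a_i} f_i, or of z^q when no divisor applies. Its
  -- leading exponent is `q` because the weight is multiplicative, so expanding `g` in these rows is
  -- a triangular system.
  let u : (Fin n →₀ ℕ) → (Fin n →₀ ℕ) → ℂ := fun q q' =>
    match c q with
    | none => if q' = q then 1 else 0
    | some i => if q - a i ≤ q' then coeff (q' - (q - a i)) (f i) else 0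
  have hu_none : ∀ {q}, c q = none → ∀ q', u q q' = if q' = q then 1 else 0 := by
    intro q h q'
    simp only [u, h]
  have hu_some : ∀ {q i}, c q = some i → ∀ q', u q q' =
      if q - a i ≤ q' then coeff (q' - (q - a i)) (f i) else 0 := by
    intro q i h q'
    simp only [u, h]
  have hu1 : ∀ q, u q q = 1 := by
    intro q
    rcases h : c q with _ | i
    · simp [hu_none h]
    · rw [hu_some h, if_pos tsub_le_self, tsub_tsub_cancel_of_le (hc_some h), hf1]
  have hu : ∀ q q', u q q' ≠ 0 → q' = q ∨ primeWeight q < primeWeight q' := by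
    intro q q' hne
    rcases h : c q with _ | i
    · rw [hu_none h] at hne
      exact Or.inl (by by_contra hh; simp [hh] at hne)
    · rw [hu_some h] at hne
      have hle : q - a i ≤ q' := by by_contra hh; simp [hh] at hne
      rw [if_pos hle] at hne
      obtain ⟨m, rfl⟩ := exists_add_of_le hle
      rw [add_tsub_cancel_left] at hne
      by_cases hm : m = a i
      · exact Or.inl (by rw [hm, tsub_add_cancel_of_le (hc_some h)])
      · right
        conv_lhs => rw [← tsub_add_cancel_of_le (hc_some h)]
        rw [primeWeight_add, primeWeight_add]
        exact Nat.mul_lt_mul_of_pos_left (hf i m hne hm) (primeWeight_pos _)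
  have hus : ∀ q, ∀ s : Finset (Fin n →₀ ℕ), q ∉ s →
      ∑ q' ∈ s, ‖u q q'‖ * wt σ q' ≤ 1 / 2 * wt σ q := by
    intro q s hqs
    rcases h : c q with _ | i
    · rw [Finset.sum_eq_zero]
      · have := wt_pos σ q; positivity
      · intro q' hq'
        rw [hu_none h, if_neg fun hh : q' = q => hqs (hh ▸ hq')]
        simp
    · have h1 : ∑ q' ∈ s, ‖u q q'‖ * wt σ q' =
          ∑ q' ∈ s with q - a i ≤ q', wt σ (q - a i) *
            (‖coeff (q' - (q - a i)) (f i)‖ * wt σ (q' - (q - a i))) := by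
        rw [Finset.sum_filter]
        refine Finset.sum_congr rfl fun q' _ => ?_
        rw [hu_some h]
        split_ifs with hle
        · conv_lhs => rw [← add_tsub_cancel_of_le hle, wt_add, add_tsub_cancel_left]
          ring
        · simp
      have h2 : Set.InjOn (fun q' => q' - (q - a i)) (s.filter fun q' => q - a i ≤ q') := by
        intro x hx y hy hxy
        have hx := (Finset.mem_filter.1 hx).2
        have hy := (Finset.mem_filter.1 hy).2
        exact (tsub_left_inj hx hy).1 hxy
      rw [h1, ← Finset.mul_sum, ← Finset.sum_image (f := fun m => ‖coeff m (f i)‖ * wt σ m) h2]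
      conv_rhs => rw [← tsub_add_cancel_of_le (hc_some h), wt_add]
      rw [mul_left_comm]
      refine mul_le_mul_of_nonneg_left (hσf i σ (hσi i) _ ?_) (wt_pos _ _).le
      intro hmem
      obtain ⟨q', hq', he⟩ := Finset.mem_image.1 hmem
      have hq' := Finset.mem_filter.1 hq'
      apply hqs
      have : q' = q := by
        rw [← tsub_add_cancel_of_le hq'.2, he, add_tsub_cancel_of_le (hc_some h)]
      exact this ▸ hq'.1
  set x := triangularSolve (fun q => coeff q g) u
  have hx : Summable fun q => ‖x q‖ * wt σ q := triangularSolve_summable hg hus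
  -- The row z^m f_i is the one with index m + a_i, whence the shift.
  let Q : ι → Germ n := fun i => ofCoeff (fun m => if c (m + a i) = some i then x (m + a i) else 0) (by
    refine ⟨σ, ?_⟩
    have h1 : Summable fun m => ‖x (m + a i)‖ * wt σ (m + a i) :=
      hx.comp_injective (add_left_injective (a i))
    refine Summable.of_nonneg_of_le (fun q => mul_nonneg (norm_nonneg _) (wt_pos _ _).le)
      (fun m => ?_) (h1.mul_left (wt σ (a i))⁻¹)
    rw [wt_add, mul_comm (wt σ m), mul_left_comm, inv_mul_cancel_left₀ (wt_pos _ _).ne']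
    refine mul_le_mul_of_nonneg_right ?_ (wt_pos _ _).le
    split_ifs <;> simp)
  let R : Germ n := ofCoeff (fun q => if c q = none then x q else 0) (by
    refine ⟨σ, Summable.of_nonneg_of_le (fun q => mul_nonneg (norm_nonneg _) (wt_pos _ _).le)
      (fun m => ?_) hx⟩
    refine mul_le_mul_of_nonneg_right ?_ (wt_pos _ _).le
    split_ifs <;> simp)
  refine ⟨Q, R, ?_, ?_⟩
  · refine Germ.ext fun q => ?_
    set D := (finite_primeWeight_lt (n := n) (primeWeight q + 1)).toFinset
    have hD : ∀ q', q' ∈ D ↔ primeWeight q' ≤ primeWeight q := fun q' => by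
      simp [D]
    rw [← triangularSolve_sum (g := fun q => coeff q g) hu1 hu q D fun q' h => (hD q').2 h]
    rw [coeff_add, coeff_sum]
    have hsplit : ∀ q', x q' * u q' q = (∑ i, if c q' = some i then x q' * u q' q else 0) +
        if c q' = none then x q' * u q' q else 0 := by
      intro q'
      rcases h : c q' with _ | i
      · simp
      · simp
    rw [Finset.sum_congr rfl fun q' _ => hsplit q', Finset.sum_add_distrib, Finset.sum_comm]
    congr 1
    · refine Finset.sum_congr rfl fun i _ => ?_
      rw [coeff_mul]
      symm
      refine Finset.sum_bij_ne_zero (fun m _ _ => m.1 + a i) ?_ ?_ ?_ ?_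
      · intro m hm hne
        rw [hD]
        have h2 := right_ne_zero_of_mul hne
        rw [← Finset.HasAntidiagonal.mem_antidiagonal.1 hm, primeWeight_add, primeWeight_add]
        refine Nat.mul_le_mul_left _ ?_
        by_cases h : m.2 = a i
        · rw [h]
        · exact (hf i _ h2 h).le
      · intro m hm _ m' hm' _ h
        have h1 : m.1 = m'.1 := add_right_cancel h
        have hm := Finset.HasAntidiagonal.mem_antidiagonal.1 hm
        have hm' := Finset.HasAntidiagonal.mem_antidiagonal.1 hm'
        rw [← hm', h1] at hm
        exact Prod.ext h1 (add_left_cancel hm)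
      · intro q' _ hne
        have hcq : c q' = some i := by by_contra h; simp [h] at hne
        rw [if_pos hcq, hu_some hcq] at hne
        have hle : q' - a i ≤ q := by by_contra h; simp [h] at hne
        rw [if_pos hle] at hne
        have hadd := tsub_add_cancel_of_le (hc_some hcq)
        refine ⟨(q' - a i, q - (q' - a i)),
          Finset.HasAntidiagonal.mem_antidiagonal.2 (add_tsub_cancel_of_le hle), ?_, hadd⟩
        simpa [Q, hadd, hcq] using hne
      · intro m hm hne
        have hm := Finset.HasAntidiagonal.mem_antidiagonal.1 hm
        have hcq : c (m.1 + a i) = some i := by by_contra h; simp [Q, h] at hne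
        rw [if_pos hcq, hu_some hcq, add_tsub_cancel_right, ← hm, if_pos le_self_add,
          add_tsub_cancel_left]
        simp [Q, hcq]
    · rw [Finset.sum_eq_single q]
      · simp [R, hu1]
      · intro q' _ hne
        split_ifs with h
        · rw [hu_none h, if_neg hne.symm, mul_zero]
        · rfl
      · intro h
        exact absurd ((hD q).2 le_rfl) h
  · intro q hq
    have : c q = none := by by_contra h; exact hq (by simp [R, h])
    exact hc_none this

end

section

variable {n : ℕ}

/-! ### Algebraic consequences of division -/

/-- Dickson's lemma. -/
theorem exists_finite_minimal (S : Set (Fin n →₀ ℕ)) :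
    ∃ A : Finset (Fin n →₀ ℕ), (A : Set (Fin n →₀ ℕ)) ⊆ S ∧ ∀ q ∈ S, ∃ a ∈ A, a ≤ q := by
  have hS : S.IsPWO := Set.isPWO_of_wellQuasiOrderedLE S
  have hfin : {x | Minimal (· ∈ S) x}.Finite :=
    (setOfPred_minimal_antichain _).finite_of_partiallyWellOrderedOn
      (Set.isPWO_of_wellQuasiOrderedLE _)
  refine ⟨hfin.toFinset, fun a ha => ?_, fun q hq => ?_⟩
  · rw [Set.Finite.coe_toFinset] at ha
    exact ha.1
  · obtain ⟨b, hb, hmin⟩ := hS.exists_le_minimal hq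
    exact ⟨b, hfin.mem_toFinset.2 hmin, hb⟩

/-! ### Monomial ideals, Noetherianity and the local ring structure -/

theorem exists_le_of_mem_span_zmon {S : Set (Fin n →₀ ℕ)} {f : Germ n}
    (hf : f ∈ Ideal.span (zmon '' S)) : supp f ⊆ {q | ∃ a ∈ S, a ≤ q} := by
  classical
  induction hf using Submodule.span_induction with
  | mem x hx =>
    obtain ⟨a, ha, rfl⟩ := hx
    intro q hq
    rw [mem_supp, coeff_zmon] at hq
    exact ⟨a, ha, le_of_eq (by by_contra h; exact hq (if_neg (Ne.symm h)))⟩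
  | zero => exact supp_zero_subset _
  | add x y _ _ hx hy => exact supp_add_subset hx hy
  | smul c x _ hx =>
    refine supp_mul_subset (Set.subset_univ (supp c)) hx ?_
    rintro a - b ⟨m, hm, hmb⟩
    exact ⟨m, hm, hmb.trans le_add_self⟩

/-- Division by the finitely many minimal monomials leaves a remainder whose exponents lie above `S`
and yet above no minimal element, so it vanishes. -/
theorem mem_span_zmon_iff {S : Set (Fin n →₀ ℕ)} {f : Germ n} :
    f ∈ Ideal.span (zmon '' S) ↔ supp f ⊆ {q | ∃ a ∈ S, a ≤ q} := by
  classical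
  refine ⟨exists_le_of_mem_span_zmon, fun hf => ?_⟩
  obtain ⟨A, hAS, hA⟩ := exists_finite_minimal S
  obtain ⟨Q, R, hg, hR⟩ := exists_division (fun a : A => a.1) (fun a => zmon a.1)
    (fun a => by simp [coeff_zmon]) (fun a q hq hne => absurd (by simp [coeff_zmon, hne]) hq) f
  have hsum : ∑ i, Q i * zmon i.1 ∈ Ideal.span (zmon '' S) :=
    Ideal.sum_mem _ fun i _ => Ideal.mul_mem_left _ _
      (Ideal.subset_span ⟨i.1, hAS i.2, rfl⟩)
  have hR0 : R = 0 := by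
    refine eq_zero_of_supp_subset_empty fun q hq => ?_
    have h1 : supp R ⊆ {q | ∃ a ∈ S, a ≤ q} := by
      rw [show R = f + -∑ i, Q i * zmon i.1 by rw [hg]; ring]
      refine supp_add_subset hf ?_
      rw [supp_neg]
      exact exists_le_of_mem_span_zmon hsum
    obtain ⟨a, ha, haq⟩ := h1 hq
    obtain ⟨b, hb, hba⟩ := hA a ha
    exact hR q hq ⟨b, hb⟩ (hba.trans haq)
  rw [hg, hR0, add_zero]
  exact hsum

theorem exists_leading_exponent {f : Germ n} (hf : f ≠ 0) :
    ∃ a ∈ supp f, ∀ q ∈ supp f, q ≠ a → primeWeight a < primeWeight q := by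
  have hne : (supp f).Nonempty := by
    by_contra h
    exact hf (eq_zero_of_supp_subset_empty fun q hq => h ⟨q, hq⟩)
  obtain ⟨a, ha, hmin⟩ := exists_minimalFor_of_wellFoundedLT (· ∈ supp f) primeWeight hne
  refine ⟨a, ha, fun q hq hqa => lt_of_le_of_ne ?_ fun h => hqa (primeWeight_injective h.symm)⟩
  rcases le_total (primeWeight a) (primeWeight q) with h | h
  · exact h
  · exact hmin hq h

/-- Standard bases: by Dickson's lemma finitely many elements of the ideal have leading exponents
below all others, and a nonzero remainder on division by them would lie in the ideal with a leading
exponent above none of these. -/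
instance : IsNoetherianRing (Germ n) := by
  classical
  refine (isNoetherianRing_iff_ideal_fg _).2 fun I => ?_
  let S : Set (Fin n →₀ ℕ) := {a | ∃ f ∈ I, coeff a f = 1 ∧
    ∀ q ∈ supp f, q ≠ a → primeWeight a < primeWeight q}
  obtain ⟨A, hAS, hA⟩ := exists_finite_minimal S
  choose f hfI hf1 hf using fun a : A => hAS a.2
  refine ⟨Finset.univ.image f, le_antisymm ?_ fun g hg => ?_⟩
  · rw [Ideal.span_le]
    intro x hx
    obtain ⟨a, -, rfl⟩ := Finset.mem_image.1 (Finset.mem_coe.1 hx)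
    exact hfI a
  · obtain ⟨Q, R, hgQ, hR⟩ := exists_division (fun a : A => a.1) f hf1 hf g
    have hR0 : R = 0 := by
      by_contra hR0
      have hRI : R ∈ I := by
        rw [show R = g - ∑ i, Q i * f i by rw [hgQ]; ring]
        exact I.sub_mem hg (I.sum_mem fun i _ => I.mul_mem_left _ (hfI i))
      obtain ⟨a, ha, hlead⟩ := exists_leading_exponent hR0
      have haS : a ∈ S := by
        refine ⟨(coeff a R)⁻¹ • R, Submodule.smul_of_tower_mem I _ hRI, ?_, fun q hq => hlead q ?_⟩
        · rw [coeff_smul, inv_mul_cancel₀ ha]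
        · rw [mem_supp, coeff_smul] at hq
          exact right_ne_zero_of_mul hq
      obtain ⟨b, hb, hba⟩ := hA a haS
      exact hR a ha ⟨b, hb⟩ hba
    rw [hgQ, hR0, add_zero]
    exact Ideal.sum_mem _ fun i _ => Ideal.mul_mem_left _ _
      (Ideal.subset_span (Finset.mem_coe.2 (Finset.mem_image_of_mem f (Finset.mem_univ i))))

theorem isUnit_of_coeff_zero_ne {f : Germ n} (hf : coeff 0 f ≠ 0) : IsUnit f := by
  obtain ⟨Q, R, h, hR⟩ := exists_division (fun _ : Unit => (0 : Fin n →₀ ℕ))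
    (fun _ => (coeff 0 f)⁻¹ • f) (fun _ => by rw [coeff_smul, inv_mul_cancel₀ hf])
    (fun _ q _ hq => by
      have h0 : primeWeight (0 : Fin n →₀ ℕ) = 1 := by simp [primeWeight]
      have h1 := primeWeight_pos q
      have h2 : primeWeight q ≠ primeWeight 0 := fun h => hq (primeWeight_injective h)
      omega) 1
  -- The leading exponent of the divisor is 0, which lies below every exponent, so nothing is left
  -- for the remainder.
  have hR0 : R = 0 := eq_zero_of_supp_subset_empty fun q hq => hR q hq () zero_le
  rw [hR0, add_zero, Fintype.sum_unique, mul_smul_comm, ← smul_mul_assoc] at h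
  exact .of_mul_eq_one_right _ h.symm

/-- Evaluation at the origin. -/
def evalZero : Germ n →+* ℂ where
  toFun f := coeff 0 f
  map_one' := by classical simp [coeff_one]
  map_mul' f g := by simp [coeff_mul]
  map_zero' := rfl
  map_add' _ _ := rfl

theorem isUnit_iff {f : Germ n} : IsUnit f ↔ coeff 0 f ≠ 0 :=
  ⟨fun h => (h.map evalZero).ne_zero, isUnit_of_coeff_zero_ne⟩

instance : Nontrivial (Germ n) := evalZero.domain_nontrivial

instance : IsLocalRing (Germ n) :=
  .of_nonunits_add fun a b ha hb => by
    simp only [mem_nonunits_iff, isUnit_iff, not_not, coeff_add] at *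
    rw [ha, hb, add_zero]

theorem mem_maximalIdeal_iff {f : Germ n} :
    f ∈ IsLocalRing.maximalIdeal (Germ n) ↔ coeff 0 f = 0 := by
  rw [IsLocalRing.mem_maximalIdeal, mem_nonunits_iff, isUnit_iff, not_not]

/-- The `N`-th powers of the coordinates. -/
def coordPowers (n N : ℕ) : List (Germ n) :=
  List.ofFn fun i : Fin n => zmon (Finsupp.single i N)

/-- Membership in a monomial ideal is read off exponents, and multiplying by z_i^N does not change
the exponents of the earlier variables. -/
theorem isWeaklyRegular_coordPowers (n N : ℕ) :
    RingTheory.Sequence.IsWeaklyRegular (Germ n) (coordPowers n N) := by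
  classical
  refine ⟨fun i hi => ?_⟩
  have hin : i < n := by simpa [coordPowers] using hi
  have hspan : (Ideal.ofList ((coordPowers n N).take i) • ⊤ : Submodule (Germ n) (Germ n)) =
      Ideal.span (zmon '' ((fun j : Fin n => Finsupp.single j N) '' {j | j.1 < i})) := by
    rw [smul_eq_mul, Ideal.mul_top, Set.image_image]
    refine congrArg Ideal.span ?_
    ext x
    simp only [Set.mem_ofPred_eq, coordPowers, List.mem_take_iff_getElem, List.length_ofFn,
      List.getElem_ofFn, Set.mem_image]
    constructor
    · rintro ⟨j, hj, rfl⟩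
      exact ⟨⟨j, by omega⟩, by change j < i; omega, rfl⟩
    · rintro ⟨j, hj, rfl⟩
      exact ⟨j.1, lt_min hj j.2, rfl⟩
  rw [hspan, isSMulRegular_quotient_iff_mem_of_smul_mem]
  intro x hx
  rw [smul_eq_mul, mul_comm, show (coordPowers n N)[i] = zmon (Finsupp.single ⟨i, hin⟩ N) by
    simp [coordPowers], mem_span_zmon_iff] at hx
  rw [mem_span_zmon_iff]
  intro q hq
  have : q + Finsupp.single ⟨i, hin⟩ N ∈ supp (x * zmon (Finsupp.single ⟨i, hin⟩ N)) := by
    rw [mem_supp, coeff_mul_zmon, if_pos le_add_self, add_tsub_cancel_right]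
    exact hq
  obtain ⟨a, ⟨j, hj, rfl⟩, hle⟩ := hx this
  refine ⟨_, ⟨j, hj, rfl⟩, ?_⟩
  have hji : (⟨i, hin⟩ : Fin n) ≠ j := by
    rintro rfl
    exact lt_irrefl i hj
  have := hle j
  simp only [Finsupp.single_eq_same, Finsupp.add_apply, Finsupp.single_apply, if_neg hji] at this
  exact Finsupp.single_le_iff.2 (by simpa using this)

theorem exists_coordPowers_mem {I : Ideal (Germ n)}
    (h : IsLocalRing.maximalIdeal (Germ n) ≤ I.radical) :
    ∃ N, ∀ x ∈ coordPowers n N, x ∈ I := by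
  classical
  have h1 : ∀ i : Fin n, ∃ N, zmon (Finsupp.single i N) ∈ I := by
    intro i
    have : zmon (Finsupp.single i 1) ∈ IsLocalRing.maximalIdeal (Germ n) := by
      rw [mem_maximalIdeal_iff, coeff_zmon, if_neg]
      exact fun h => one_ne_zero (Finsupp.single_eq_zero.1 h.symm)
    obtain ⟨N, hN⟩ := h this
    rw [zmon_pow] at hN
    exact ⟨N, by simpa using hN⟩
  choose N hN using h1
  refine ⟨∑ i, N i, fun x hx => ?_⟩
  obtain ⟨i, rfl⟩ := (List.mem_ofFn' _ _).1 hx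
  have hle : N i ≤ ∑ i, N i := Finset.single_le_sum (fun _ _ => Nat.zero_le _) (Finset.mem_univ i)
  change zmon (Finsupp.single i (∑ i, N i)) ∈ I
  rw [← Nat.sub_add_cancel hle, Finsupp.single_add, ← zmon_mul]
  exact I.mul_mem_left _ (hN i)

end

/-! ### The Koszul complex of a finite sequence with coefficients in a module -/

section KoszulModule

variable {R : Type*} [CommRing R] {M : Type*} [AddCommGroup M] [Module R M]

/-- The sign `(-1)^{#{j ∈ I, j < i}}`. -/
def ksign (R : Type*) [CommRing R] {ι : Type*} [LinearOrder ι] (I : Finset ι) (i : ι) : R :=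
  (-1) ^ (I.filter (· < i)).card

theorem ksign_mul_self {ι : Type*} [LinearOrder ι] (I : Finset ι) (i : ι) :
    ksign R I i * ksign R I i = 1 := by
  rw [ksign, ← mul_pow]
  simp

theorem ksign_insert {ι : Type*} [LinearOrder ι] {I : Finset ι} {j : ι} (hj : j ∉ I) (i : ι) :
    ksign R (insert j I) i = (if j < i then -1 else 1) * ksign R I i := by
  unfold ksign
  rw [Finset.filter_insert]
  split_ifs with h
  · rw [Finset.card_insert_of_notMem (fun hh => hj (Finset.mem_filter.1 hh).1), pow_succ']
  · rw [one_mul]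

theorem ksign_swap {ι : Type*} [LinearOrder ι] {I : Finset ι} {i j : ι} (hi : i ∉ I) (hj : j ∉ I)
    (hij : i ≠ j) :
    ksign R I i * ksign R (insert i I) j = -(ksign R I j * ksign R (insert j I) i) := by
  rw [ksign_insert hi, ksign_insert hj]
  rcases lt_or_gt_of_ne hij with h | h
  · rw [if_pos h, if_neg h.le.not_gt]; ring
  · rw [if_pos h, if_neg h.le.not_gt]; ring

/-- The Koszul differential of `h 0, …, h (m - 1)` on families indexed by finite sets. -/
def kd (M : Type*) [AddCommGroup M] [Module R M] (h : ℕ → R) (m : ℕ) :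
    (Finset ℕ → M) →ₗ[R] (Finset ℕ → M) :=
  LinearMap.pi fun I => ∑ i ∈ Finset.range m \ I,
    (ksign R I i * h i) • LinearMap.proj (R := R) (φ := fun _ => M) (insert i I)

theorem kd_apply (h : ℕ → R) (m : ℕ) (x : Finset ℕ → M) (I : Finset ℕ) :
    kd M h m x I = ∑ i ∈ Finset.range m \ I, (ksign R I i * h i) • x (insert i I) := by
  simp [kd]

/-- The terms inserting i then j and j then i cancel by `ksign_swap`. -/
theorem kd_kd (h : ℕ → R) (m : ℕ) (x : Finset ℕ → M) : kd M h m (kd M h m x) = 0 := by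
  ext I
  rw [kd_apply]
  simp only [kd_apply, Finset.smul_sum, smul_smul]
  rw [Finset.sum_sigma']
  refine Finset.sum_involution (fun p _ => ⟨p.2, p.1⟩) ?_ ?_ ?_ ?_
  · rintro ⟨i, j⟩ hp
    simp only [Finset.mem_sigma, Finset.mem_sdiff, Finset.mem_insert, not_or] at hp
    rw [Finset.insert_comm j i, ← add_smul]
    convert zero_smul R _ using 2
    linear_combination (h i * h j) * ksign_swap (R := R) hp.1.2 hp.2.2.2 (Ne.symm hp.2.2.1)
  · rintro ⟨i, j⟩ hp _ he
    simp only [Finset.mem_sigma, Finset.mem_sdiff, Finset.mem_insert, not_or] at hp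
    simp only [Sigma.mk.injEq, heq_eq_eq] at he
    exact hp.2.2.1 he.1
  · rintro ⟨i, j⟩ hp
    simp only [Finset.mem_sigma, Finset.mem_sdiff, Finset.mem_insert, not_or] at hp ⊢
    exact ⟨⟨hp.2.1, hp.2.2.2⟩, hp.1.1, Ne.symm hp.2.2.1, hp.1.2⟩
  · rintro ⟨i, j⟩ _
    rfl

theorem kd_map {M' : Type*} [AddCommGroup M'] [Module R M'] (φ : M →ₗ[R] M') (h : ℕ → R) (m : ℕ)
    (x : Finset ℕ → M) : kd M' h m (fun I => φ (x I)) = fun I => φ (kd M h m x I) := by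
  ext I
  simp [kd_apply]

/-- The elements of degree `i` of the Koszul complex of `h 0, …, h (m - 1)`. -/
def koszulDeg (R : Type*) [CommRing R] (M : Type*) [AddCommGroup M] [Module R M] (m i : ℕ) :
    Submodule R (Finset ℕ → M) where
  carrier := {x | ∀ I, ¬ (I ⊆ Finset.range m ∧ I.card = i) → x I = 0}
  add_mem' hx hy I hI := by simp [hx I hI, hy I hI]
  zero_mem' _ _ := rfl
  smul_mem' c x hx I hI := by simp [hx I hI]

theorem kd_mem {h : ℕ → R} {m i : ℕ} {x : Finset ℕ → M} (hx : x ∈ koszulDeg R M m (i + 1)) :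
    kd M h m x ∈ koszulDeg R M m i := by
  intro I hI
  rw [kd_apply]
  refine Finset.sum_eq_zero fun j hj => ?_
  rw [Finset.mem_sdiff] at hj
  rw [hx, smul_zero]
  rintro ⟨h1, h2⟩
  rw [Finset.card_insert_of_notMem hj.2] at h2
  exact hI ⟨(Finset.subset_insert _ _).trans h1, by omega⟩

/-- Cycles of degree `i` are boundaries. -/
def KoszulExact (M : Type*) [AddCommGroup M] [Module R M] (h : ℕ → R) (m i : ℕ) : Prop :=
  ∀ z ∈ koszulDeg R M m i, kd M h m z = 0 → ∃ y ∈ koszulDeg R M m (i + 1), kd M h m y = z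

theorem koszulExact_of_lt (h : ℕ → R) {m i : ℕ} (him : m < i) : KoszulExact M h m i := by
  intro z hz _
  refine ⟨0, Submodule.zero_mem _, ?_⟩
  rw [map_zero]
  ext I
  rw [hz I, Pi.zero_apply]
  rintro ⟨h1, h2⟩
  have := Finset.card_le_card h1
  rw [Finset.card_range] at this
  omega

/-- Exterior multiplication with the `j`-th basis element. -/
def wedge (R : Type*) [CommRing R] {M : Type*} [AddCommGroup M] [Module R M] (j : ℕ)
    (z : Finset ℕ → M) (I : Finset ℕ) : M :=
  if j ∈ I then ksign R (I.erase j) j • z (I.erase j) else 0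

theorem wedge_mem {m i j : ℕ} (hj : j < m) {z : Finset ℕ → M} (hz : z ∈ koszulDeg R M m i) :
    wedge R j z ∈ koszulDeg R M m (i + 1) := by
  intro I hI
  unfold wedge
  split_ifs with h
  · rw [hz, smul_zero]
    rintro ⟨h1, h2⟩
    rw [Finset.card_erase_of_mem h] at h2
    have := Finset.card_pos.2 ⟨j, h⟩
    refine hI ⟨fun a ha => ?_, by omega⟩
    by_cases haj : a = j
    · simpa [haj] using hj
    · exact h1 (Finset.mem_erase.2 ⟨haj, ha⟩)
  · rfl

/-- The homotopy formula d(e_j ∧ z) + e_j ∧ dz = h_j z for a cycle z. At an index set containing j,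
the equation dz = 0 is used at the set without j; otherwise only the summand for j survives. -/
theorem kd_wedge (h : ℕ → R) {m j : ℕ} (hj : j < m) {z : Finset ℕ → M} (hz : kd M h m z = 0) :
    kd M h m (wedge R j z) = h j • z := by
  ext I
  rw [kd_apply, Pi.smul_apply]
  by_cases hI : j ∈ I
  · have h0 := congrFun hz (I.erase j)
    rw [kd_apply, Pi.zero_apply] at h0
    have hset : Finset.range m \ I.erase j = insert j (Finset.range m \ I) := by
      ext a
      simp only [Finset.mem_sdiff, Finset.mem_range, Finset.mem_erase, Finset.mem_insert]
      by_cases ha : a = j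
      · simp [ha, hj]
      · simp [ha]
    rw [hset, Finset.sum_insert (by simp [hI]), Finset.insert_erase hI] at h0
    have hsum : ∑ i ∈ Finset.range m \ I, (ksign R I i * h i) • wedge R j z (insert i I) =
        -(ksign R (I.erase j) j • ∑ i ∈ Finset.range m \ I,
          (ksign R (I.erase j) i * h i) • z (insert i (I.erase j))) := by
      rw [Finset.smul_sum, ← Finset.sum_neg_distrib]
      refine Finset.sum_congr rfl fun i hi => ?_
      have hi := (Finset.mem_sdiff.1 hi).2
      have hij : i ≠ j := fun h => hi (h ▸ hI)
      have hswap := ksign_swap (R := R) (I := I.erase j) (i := i) (j := j)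
        (fun h => hi (Finset.mem_of_mem_erase h)) (Finset.notMem_erase j I) hij
      rw [Finset.insert_erase hI] at hswap
      have h2 := ksign_mul_self (R := R) (insert i (I.erase j)) j
      have h3 := ksign_mul_self (R := R) (I.erase j) j
      rw [wedge, if_pos (Finset.mem_insert_of_mem hI), Finset.erase_insert_of_ne hij, smul_smul,
        smul_smul, ← neg_smul]
      congr 1
      have hsgn : ksign R I i * ksign R (insert i (I.erase j)) j =
          -(ksign R (I.erase j) j * ksign R (I.erase j) i) := by
        linear_combination (ksign R (I.erase j) j * ksign R (insert i (I.erase j)) j) * hswap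
          - ksign R (I.erase j) j * ksign R (I.erase j) i * h2 +
          ksign R I i * ksign R (insert i (I.erase j)) j * (-h3)
      linear_combination h i * hsgn
    rw [hsum, eq_neg_of_add_eq_zero_right h0, smul_neg, neg_neg, smul_smul, ← mul_assoc,
      ksign_mul_self, one_mul]
  · rw [Finset.sum_eq_single j]
    · rw [wedge, if_pos (Finset.mem_insert_self j I), Finset.erase_insert hI, smul_smul,
        mul_right_comm, ksign_mul_self, one_mul]
    · intro i _ hij
      rw [wedge, if_neg, smul_zero]
      simp [hI, Ne.symm hij]
    · intro hj'
      exact absurd (Finset.mem_sdiff.2 ⟨Finset.mem_range.2 hj, hI⟩) hj'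

theorem exists_kd_eq_smul {h : ℕ → R} {m i : ℕ} {c : R}
    (hc : c ∈ Ideal.span (h '' {j | j < m})) {z : Finset ℕ → M} (hz : z ∈ koszulDeg R M m i)
    (hdz : kd M h m z = 0) : ∃ w ∈ koszulDeg R M m (i + 1), kd M h m w = c • z := by
  induction hc using Submodule.span_induction with
  | mem x hx =>
    obtain ⟨j, hj, rfl⟩ := hx
    exact ⟨wedge R j z, wedge_mem hj hz, kd_wedge h hj hdz⟩
  | zero => exact ⟨0, Submodule.zero_mem _, by simp⟩
  | add x y _ _ hx hy =>
    obtain ⟨w, hw, hw'⟩ := hx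
    obtain ⟨v, hv, hv'⟩ := hy
    exact ⟨w + v, Submodule.add_mem _ hw hv, by rw [map_add, hw', hv', add_smul]⟩
  | smul a x _ hx =>
    obtain ⟨w, hw, hw'⟩ := hx
    exact ⟨a • w, Submodule.smul_mem _ a hw, by rw [map_smul, hw', smul_eq_mul, mul_smul]⟩

/-- Since c annihilates the homology, the long exact sequence of multiplication by c makes
H_{i+1}(M/cM) → H_i(M) surjective. By hand: cz = dw, then w = dv + cu because w is a cycle modulo c,
and c may be cancelled in c·du = cz. -/
theorem koszulExact_of_quotSMulTop {h : ℕ → R} {m i : ℕ} {c : R}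
    (hc : c ∈ Ideal.span (h '' {j | j < m})) (hreg : IsSMulRegular M c)
    (hex : KoszulExact (QuotSMulTop c M) h m (i + 1)) : KoszulExact M h m i := by
  intro z hz hdz
  obtain ⟨w, hw, hdw⟩ := exists_kd_eq_smul hc hz hdz
  let π : M →ₗ[R] QuotSMulTop c M := Submodule.mkQ _
  have hπ : ∀ x, π x = 0 ↔ ∃ y, c • y = x := fun x => by
    simp only [π, Submodule.mkQ_apply, Submodule.Quotient.mk_eq_zero,
      Submodule.mem_smul_pointwise_iff_exists, Submodule.mem_top, true_and]
  obtain ⟨v', hv', hdv'⟩ := hex (fun I => π (w I)) (fun I hI => by simp [hw I hI]) (by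
    rw [kd_map, hdw]
    ext I
    exact (hπ _).2 ⟨z I, rfl⟩)
  -- Lifting 0 to 0 keeps the lifted chain in its degree.
  have hlift : ∀ I, ∃ x : M, π x = v' I ∧ (v' I = 0 → x = 0) := by
    intro I
    by_cases h0 : v' I = 0
    · exact ⟨0, by rw [h0, map_zero], fun _ => rfl⟩
    · obtain ⟨x, hx⟩ := Submodule.mkQ_surjective _ (v' I)
      exact ⟨x, hx, fun h => absurd h h0⟩
  choose v hv hv0 using hlift
  have hvmem : v ∈ koszulDeg R M m (i + 1 + 1) := fun I hI => hv0 I (hv' I hI)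
  have hdiff : ∀ I, ∃ y, c • y = w I - kd M h m v I := by
    intro I
    rw [← hπ, map_sub, sub_eq_zero]
    have h1 := congrFun (kd_map π h m v) I
    rw [← h1, ← congrFun hdv' I]
    simp only [hv]
  choose u hu using hdiff
  have hcu : c • u = w - kd M h m v := funext hu
  refine ⟨u, fun I hI => hreg ?_, ?_⟩
  · simp only [smul_zero]
    rw [hu, hw I hI, kd_mem hvmem I hI, sub_zero]
  · have : c • kd M h m u = c • z := by
      rw [← map_smul, hcu, map_sub, kd_kd, sub_zero, hdw]
    ext I
    exact hreg (congrFun this I)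

/-- Each element of the regular sequence trades exactness in degree i for exactness in degree i + 1
over a quotient; in degrees above m there are no chains. -/
theorem koszulExact_of_isWeaklyRegular {h : ℕ → R} {m : ℕ} (rs : List R) :
    ∀ {M : Type*} [AddCommGroup M] [Module R M] {i : ℕ},
      RingTheory.Sequence.IsWeaklyRegular M rs → (∀ x ∈ rs, x ∈ Ideal.span (h '' {j | j < m})) →
      m < i + rs.length → KoszulExact M h m i := by
  induction rs with
  | nil => exact fun _ _ hi => koszulExact_of_lt h hi
  | cons c rs ih =>
    intro M _ _ i hreg hmem hi
    rw [RingTheory.Sequence.isWeaklyRegular_cons_iff] at hreg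
    refine koszulExact_of_quotSMulTop (hmem c List.mem_cons_self) hreg.1
      (ih hreg.2 (fun x hx => hmem x (List.mem_cons_of_mem c hx)) ?_)
    rw [List.length_cons] at hi
    omega

theorem koszulExact_of_one_mem {h : ℕ → R} {m i : ℕ}
    (hc : 1 ∈ Ideal.span (h '' {j | j < m})) : KoszulExact M h m i := by
  intro z hz hdz
  obtain ⟨w, hw, hdw⟩ := exists_kd_eq_smul hc hz hdz
  exact ⟨w, hw, by rw [hdw, one_smul]⟩

theorem isNoetherian_koszulDeg [IsNoetherian R M] (m i : ℕ) :
    IsNoetherian R (koszulDeg R M m i) := by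
  let φ : koszulDeg R M m i →ₗ[R] ((Finset.range m).powerset → M) :=
    (LinearMap.pi fun I => LinearMap.proj (R := R) (φ := fun _ => M) I.1).comp
      (koszulDeg R M m i).subtype
  refine isNoetherian_of_injective φ fun x y hxy => Subtype.ext (funext fun I => ?_)
  by_cases hI : I ⊆ Finset.range m
  · exact congrFun hxy ⟨I, Finset.mem_powerset.2 hI⟩
  · rw [x.2 I fun h => hI h.1, y.2 I fun h => hI h.1]

/-- Removing the last element of the sequence. -/
theorem koszulExact_of_succ [IsLocalRing R] [IsNoetherian R M] {h : ℕ → R} {m i : ℕ}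
    (hm : h m ∈ IsLocalRing.maximalIdeal R) (hex : KoszulExact M h (m + 1) i) :
    KoszulExact M h m i := by
  let Z : Submodule R (Finset ℕ → M) := koszulDeg R M m i ⊓ LinearMap.ker (kd M h m)
  let B : Submodule R (Finset ℕ → M) := (koszulDeg R M m (i + 1)).map (kd M h m)
  have hZfg : Z.FG := (isNoetherian_submodule.1 (isNoetherian_koszulDeg m i)) Z inf_le_left
  -- Cycles are boundaries up to multiples of h_m, as in the exact sequence H_i(h_{<m}) →
  -- H_i(h_{<m}) → H_i(h_{≤m}) whose first map is h_m. Nakayama's lemma then gives Z ≤ B.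
  have hle : Z ≤ B ⊔ IsLocalRing.maximalIdeal R • Z := by
    rintro z ⟨hz, hdz⟩
    have hdz : kd M h m z = 0 := hdz
    have hnot : ∀ {I : Finset ℕ}, I ⊆ Finset.range m → m ∉ I := fun hI hmI => by
      simpa using hI hmI
    have hsdiff : ∀ {I : Finset ℕ}, m ∉ I →
        Finset.range (m + 1) \ I = insert m (Finset.range m \ I) := by
      intro I hI
      rw [Finset.range_add_one, Finset.insert_sdiff_of_notMem _ hI]
    obtain ⟨y, hy, hdy⟩ := hex z (fun I hI => hz I fun h => hI
        ⟨h.1.trans (Finset.range_subset_range.2 (Nat.le_succ m)), h.2⟩) (by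
      ext I
      rw [kd_apply]
      by_cases hI : m ∈ I
      · refine Finset.sum_eq_zero fun j _ => ?_
        rw [hz, smul_zero]
        exact fun h => hnot h.1 (Finset.mem_insert_of_mem hI)
      · rw [hsdiff hI, Finset.sum_insert (by simp), ← kd_apply, hdz, hz, smul_zero, zero_add]
        exact fun h => hnot h.1 (Finset.mem_insert_self _ _))
    -- The primitive y in the longer complex is split into the part without e_m and the coefficient
    -- of e_m. The latter is a cycle because z does not involve e_m.
    let y₀ : Finset ℕ → M := fun I => if I ⊆ Finset.range m then y I else 0
    let y₁ : Finset ℕ → M := fun I => if I ⊆ Finset.range m then y (insert m I) else 0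
    have hy₀ : y₀ ∈ koszulDeg R M m (i + 1) := by
      intro I hI
      by_cases hIm : I ⊆ Finset.range m
      · simp only [y₀, if_pos hIm]
        exact hy I fun h => hI ⟨hIm, h.2⟩
      · simp only [y₀, if_neg hIm]
    have hy₁ : y₁ ∈ koszulDeg R M m i := by
      intro I hI
      by_cases hIm : I ⊆ Finset.range m
      · simp only [y₁, if_pos hIm]
        refine hy _ fun h => hI ⟨hIm, ?_⟩
        have := h.2
        rw [Finset.card_insert_of_notMem (hnot hIm)] at this
        omega
      · simp only [y₁, if_neg hIm]
    have hins : ∀ {I : Finset ℕ}, I ⊆ Finset.range m → ∀ j ∈ Finset.range m \ I,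
        insert j I ⊆ Finset.range m := fun hI j hj =>
      Finset.insert_subset (Finset.mem_sdiff.1 hj).1 hI
    have hdy₁ : kd M h m y₁ = 0 := by
      ext I
      by_cases hI : I ⊆ Finset.range m
      · have h1 := congrFun hdy (insert m I)
        rw [hz _ (fun h => hnot h.1 (Finset.mem_insert_self _ _)), kd_apply] at h1
        have hset : Finset.range (m + 1) \ insert m I = Finset.range m \ I := by
          ext a
          simp only [Finset.mem_sdiff, Finset.mem_range, Finset.mem_insert]
          constructor
          · rintro ⟨h1, h2⟩
            exact ⟨by omega, fun h => h2 (Or.inr h)⟩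
          · rintro ⟨h1, h2⟩
            exact ⟨by omega, fun h => h.elim (by omega) h2⟩
        rw [kd_apply, Pi.zero_apply, ← h1, hset]
        refine Finset.sum_congr rfl fun j hj => ?_
        have hjm : j < m := Finset.mem_range.1 (Finset.mem_sdiff.1 hj).1
        simp only [y₁, if_pos (hins hI j hj)]
        rw [ksign_insert (hnot hI), if_neg hjm.le.not_gt, one_mul, Finset.insert_comm]
      · rw [kd_apply]
        refine Finset.sum_eq_zero fun j _ => ?_
        simp only [y₁]
        rw [if_neg (fun h => hI ((Finset.subset_insert _ _).trans h)), smul_zero]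
    -- The sign is (-1)^i because m exceeds all i elements of the index set.
    have hzeq : z = kd M h m y₀ + h m • ((-1 : R) ^ i • y₁) := by
      ext I
      by_cases hI : I ⊆ Finset.range m
      · rw [← hdy, kd_apply, hsdiff (hnot hI), Finset.sum_insert (by simp), add_comm]
        simp only [Pi.add_apply, Pi.smul_apply]
        congr 1
        · rw [kd_apply]
          refine Finset.sum_congr rfl fun j hj => ?_
          simp only [y₀, if_pos (hins hI j hj)]
        · simp only [y₁, if_pos hI, smul_smul]
          by_cases hc : I.card = i
          · rw [mul_comm, ksign, Finset.filter_true_of_mem, hc]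
            exact fun a ha => Finset.mem_range.1 (hI ha)
          · rw [hy, smul_zero, smul_zero]
            rintro ⟨-, h2⟩
            rw [Finset.card_insert_of_notMem (hnot hI)] at h2
            omega
      · rw [hz I fun h => hI h.1]
        simp only [Pi.add_apply, Pi.smul_apply]
        rw [kd_mem hy₀ I fun h => hI h.1, hy₁ I fun h => hI h.1]
        simp
    rw [hzeq]
    refine Submodule.add_mem_sup ⟨y₀, hy₀, rfl⟩ (Submodule.smul_mem_smul hm ?_)
    exact Submodule.smul_mem _ _ ⟨hy₁, hdy₁⟩
  have hZB : Z ≤ B := Submodule.le_of_le_smul_of_le_jacobson_bot hZfg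
    (IsLocalRing.maximalIdeal_le_jacobson _) hle
  intro z hz hdz
  obtain ⟨y, hy, hdy⟩ := hZB ⟨hz, hdz⟩
  exact ⟨y, hy, hdy⟩

theorem koszulExact_of_add [IsLocalRing R] [IsNoetherian R M] {h : ℕ → R} {m i : ℕ} (d : ℕ)
    (hm : ∀ j, m ≤ j → j < m + d → h j ∈ IsLocalRing.maximalIdeal R)
    (hex : KoszulExact M h (m + d) i) : KoszulExact M h m i := by
  induction d with
  | zero => exact hex
  | succ d ih =>
    exact ih (fun j h1 h2 => hm j h1 (by omega))
      (koszulExact_of_succ (hm (m + d) (by omega) (by omega)) hex)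

end KoszulModule

section

variable {n : ℕ}

/-! ### Depth sensitivity of the Koszul complex in the ring of germs -/

theorem maximalIdeal_le_radical_of_mem_minimalPrimes {R : Type*} [CommRing R] [IsLocalRing R]
    {J : Ideal R} (h : IsLocalRing.maximalIdeal R ∈ J.minimalPrimes) :
    IsLocalRing.maximalIdeal R ≤ J.radical := by
  rw [Ideal.radical_eq_sInf]
  refine le_sInf fun P hP => ?_
  exact h.2 ⟨hP.2, hP.1⟩ (IsLocalRing.le_maximalIdeal hP.2.ne_top)

/-- By the converse of Krull's height theorem, the maximal ideal of R/I is minimal over as many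
elements as its height, which is the dimension. These are lifted to R. -/
theorem exists_parameters {R : Type*} [CommRing R] [IsLocalRing R] [IsNoetherianRing R]
    {I : Ideal R} (hI : I ≠ ⊤) {d : ℕ} (hd : ringKrullDim (R ⧸ I) ≤ d) :
    ∃ s : Finset R, s.card ≤ d ∧ (s : Set R) ⊆ IsLocalRing.maximalIdeal R ∧
      IsLocalRing.maximalIdeal R ≤ (I ⊔ Ideal.span (s : Set R)).radical := by
  classical
  have : Nontrivial (R ⧸ I) := Ideal.Quotient.nontrivial_iff.2 hI
  have hloc : IsLocalRing (R ⧸ I) :=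
    IsLocalRing.of_surjective' (Ideal.Quotient.mk I) Ideal.Quotient.mk_surjective
  have hlocal : IsLocalHom (Ideal.Quotient.mk I) :=
    IsLocalHom.of_surjective (Ideal.Quotient.mk I) Ideal.Quotient.mk_surjective
  obtain ⟨s, hs, hcard⟩ := (IsLocalRing.maximalIdeal
    (R ⧸ I)).exists_finset_card_eq_height_of_isNoetherianRing
  choose l hl using Ideal.Quotient.mk_surjective (I := I)
  have hspan : Ideal.span (s : Set (R ⧸ I)) =
      (Ideal.span ((s.image l : Finset R) : Set R)).map (Ideal.Quotient.mk I) := by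
    rw [Ideal.map_span, Finset.coe_image, Set.image_image]
    simp [hl]
  refine ⟨s.image l, ?_, ?_, ?_⟩
  · have h1 : ((s.card : ℕ∞) : WithBot ℕ∞) ≤ ((d : ℕ∞) : WithBot ℕ∞) := by
      rw [hcard, IsLocalRing.maximalIdeal_height_eq_ringKrullDim]
      exact hd
    exact Finset.card_image_le.trans (by exact_mod_cast h1)
  · intro x hx
    obtain ⟨y, hy, rfl⟩ := Finset.mem_image.1 (Finset.mem_coe.1 hx)
    have hy' : y ∈ IsLocalRing.maximalIdeal (R ⧸ I) :=
      hs.1.2 (Ideal.subset_span (Finset.mem_coe.2 hy))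
    rw [← hl y] at hy'
    rw [SetLike.mem_coe, IsLocalRing.mem_maximalIdeal, mem_nonunits_iff] at *
    exact fun hu => hy' (hu.map _)
  · intro x hx
    have hx' : Ideal.Quotient.mk I x ∈ IsLocalRing.maximalIdeal (R ⧸ I) := by
      rw [IsLocalRing.mem_maximalIdeal, mem_nonunits_iff] at *
      exact fun hu => hx (isUnit_of_map_unit _ x hu)
    obtain ⟨N, hN⟩ := maximalIdeal_le_radical_of_mem_minimalPrimes hs hx'
    refine ⟨N, ?_⟩
    rw [hspan, ← map_pow, Ideal.mem_quotient_iff_mem_sup, sup_comm] at hN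
    exact hN

/-- With d at least the dimension of the zero germ and d + k ≤ n + s, the family with at most d
parameters has length at most n + s, while its ideal contains a weakly regular sequence of length n.
This kills degrees above s. -/
theorem koszulExact_of_codimGE {k s : ℕ} {f : Fin k → Germ n} (hf : CodimGE f s) {i : ℕ}
    (hi : s < i) : ∃ h : ℕ → Germ n, (∀ j : Fin k, h j = f j) ∧ KoszulExact (Germ n) h k i := by
  classical
  -- An empty germ has dimension ⊥, which gives no numerical bound; here 1 lies in the ideal and
  -- annihilates the homology.
  by_cases hI : Ideal.span (Set.range f) = ⊤
  · refine ⟨fun j => if h : j < k then f ⟨j, h⟩ else 0, fun j => by simp, ?_⟩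
    refine koszulExact_of_one_mem ?_
    rw [Ideal.eq_top_iff_one] at hI
    refine Ideal.span_mono ?_ hI
    rintro _ ⟨j, rfl⟩
    exact ⟨j, j.2, by simp⟩
  have : Nontrivial (Germ n ⧸ Ideal.span (Set.range f)) := Ideal.Quotient.nontrivial_iff.2 hI
  -- The dimension is a natural number: ⊥ is excluded because the quotient is nontrivial, ⊤ by the
  -- bound.
  obtain ⟨d, hd, hle⟩ : ∃ d : ℕ, ringKrullDim (Germ n ⧸ Ideal.span (Set.range f)) ≤ d ∧
      d + k ≤ n + s := by
    unfold CodimGE at hf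
    generalize hx : ringKrullDim (Germ n ⧸ Ideal.span (Set.range f)) = x at hf
    have h0 : 0 ≤ x := hx ▸ ringKrullDim_nonneg_of_nontrivial
    induction x using WithBot.recBotCoe with
    | bot => exact absurd h0 (by decide)
    | coe x =>
      induction x using ENat.recTopCoe with
      | top => exact absurd hf (by exact_mod_cast (by simp : ¬ (⊤ : ℕ∞) + k ≤ ((n + s : ℕ) : ℕ∞)))
      | coe d => exact ⟨d, le_rfl, by exact_mod_cast hf⟩
  obtain ⟨t, htcard, htm, hrad⟩ := exists_parameters hI hd
  obtain ⟨N, hN⟩ := exists_coordPowers_mem hrad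
  let e := t.equivFin.symm
  let h : ℕ → Germ n := fun j => if h : j < k then f ⟨j, h⟩ else
    if h' : j - k < t.card then (e ⟨j - k, h'⟩).1 else 0
  have hhf : ∀ j : Fin k, h j = f j := fun j => by simp [h]
  refine ⟨h, hhf, koszulExact_of_add t.card ?_ ?_⟩
  · intro j h1 h2
    simp only [h, dif_neg (not_lt.2 h1), dif_pos (show j - k < t.card by omega)]
    exact htm (e _).2
  · refine koszulExact_of_isWeaklyRegular _ (isWeaklyRegular_coordPowers n N) ?_ ?_
    · intro x hx
      have hsup : Ideal.span (Set.range f) ⊔ Ideal.span (t : Set (Germ n)) ≤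
          Ideal.span (h '' {j | j < k + t.card}) := by
        refine sup_le (Ideal.span_mono ?_) (Ideal.span_mono ?_)
        · rintro _ ⟨j, rfl⟩
          exact ⟨j, by change j.1 < k + t.card; omega, hhf j⟩
        · intro y hy
          set j := e.symm ⟨y, hy⟩
          refine ⟨k + j, by change k + j.1 < k + t.card; omega, ?_⟩
          simp only [h, dif_neg (show ¬ k + j.1 < k by omega), add_tsub_cancel_left, j.2]
          simp [j]
      exact hsup (hN x hx)
    · simp only [coordPowers, List.length_ofFn]
      omega

/-! ### Comparison with the Koszul complex of a finite family -/

/-- Restriction of a family indexed by finite sets of natural numbers. -/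
def koszulPull {k : ℕ} (s : ℕ) (y : Finset ℕ → Germ n) : Koszul n k s :=
  fun I => y (I.1.map Fin.valEmbedding)

theorem koszulD_apply {k : ℕ} (g : Fin k → Germ n) (s : ℕ) (x : Koszul n k (s + 1))
    (I : {I : Finset (Fin k) // I.card = s}) :
    koszulD g s x I = ∑ i : {i : Fin k // i ∉ I.1}, ksign (Germ n) I.1 i.1 * g i.1 *
      x ⟨insert i.1 I.1, by rw [Finset.card_insert_of_notMem i.2, I.2]⟩ := by
  simp only [koszulD, LinearMap.pi_apply, LinearMap.sum_apply, LinearMap.smul_apply,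
    LinearMap.proj_apply, smul_eq_mul, ksign]

theorem ksign_map {k : ℕ} (I : Finset (Fin k)) (i : Fin k) :
    ksign (Germ n) (I.map Fin.valEmbedding) (i : ℕ) = ksign (Germ n) I i := by
  unfold ksign
  rw [Finset.filter_map, Finset.card_map]
  rfl

theorem koszulD_koszulPull {k : ℕ} {g : Fin k → Germ n} {h : ℕ → Germ n}
    (hg : ∀ j : Fin k, h j = g j) (s : ℕ) (y : Finset ℕ → Germ n) :
    koszulD g s (koszulPull (s + 1) y) = koszulPull s (kd (Germ n) h k y) := by
  ext1 I
  rw [koszulD_apply, koszulPull, kd_apply]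
  have key : ∀ i : {i : Fin k // i ∉ I.1}, i.1.1 ∈ Finset.range k \ I.1.map Fin.valEmbedding := by
    intro i
    rw [Finset.mem_sdiff, Finset.mem_range, Finset.mem_map]
    refine ⟨i.1.2, ?_⟩
    rintro ⟨j, hj, hji⟩
    exact i.2 (Fin.ext hji ▸ hj)
  refine Finset.sum_bij (fun i _ => i.1.1) (fun i _ => key i) ?_ ?_ ?_
  · intro i _ j _ hij
    exact Subtype.ext (Fin.ext hij)
  · intro j hj
    rw [Finset.mem_sdiff, Finset.mem_range] at hj
    exact ⟨⟨⟨j, hj.1⟩, fun hjI => hj.2 (Finset.mem_map.2 ⟨_, hjI, rfl⟩)⟩, Finset.mem_univ _, rfl⟩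
  · intro i _
    rw [ksign_map, hg, koszulPull, smul_eq_mul]
    congr 2
    simp [Finset.map_insert]

theorem exists_koszulPull_eq {k s : ℕ} (x : Koszul n k s) :
    ∃ z ∈ koszulDeg (Germ n) (Germ n) k s, koszulPull s z = x := by
  classical
  refine ⟨fun J => if h : ∃ I : {I : Finset (Fin k) // I.card = s},
    I.1.map Fin.valEmbedding = J then x h.choose else 0, fun J hJ => dif_neg ?_, ?_⟩
  · rintro ⟨I, rfl⟩
    refine hJ ⟨fun a ha => ?_, by rw [Finset.card_map, I.2]⟩
    obtain ⟨i, -, rfl⟩ := Finset.mem_map.1 ha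
    exact Finset.mem_range.2 i.2
  · ext1 I
    have hex : ∃ I' : {I : Finset (Fin k) // I.card = s},
      I'.1.map Fin.valEmbedding = I.1.map Fin.valEmbedding := ⟨I, rfl⟩
    rw [koszulPull, dif_pos hex]
    congr 1
    exact Subtype.ext (Finset.map_injective _ hex.choose_spec)

theorem koszulPull_injOn {k s : ℕ} {y z : Finset ℕ → Germ n}
    (hy : y ∈ koszulDeg (Germ n) (Germ n) k s) (hz : z ∈ koszulDeg (Germ n) (Germ n) k s)
    (h : koszulPull (k := k) s y = koszulPull s z) : y = z := by
  ext1 J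
  by_cases hJ : J ⊆ Finset.range k ∧ J.card = s
  · have hlt : ∀ a ∈ J, a < k := fun a ha => Finset.mem_range.1 (hJ.1 ha)
    have hmap : (J.attachFin hlt).map Fin.valEmbedding = J := by
      ext a
      simp only [Finset.mem_map, Finset.mem_attachFin, Fin.valEmbedding_apply]
      exact ⟨fun ⟨i, hi, hia⟩ => hia ▸ hi, fun ha => ⟨⟨a, hlt a ha⟩, ha, rfl⟩⟩
    have := congrFun h ⟨J.attachFin hlt, by rw [Finset.card_attachFin, hJ.2]⟩
    simpa only [koszulPull, hmap] using this
  · rw [hy J hJ, hz J hJ]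

theorem koszulD_koszulD {k : ℕ} (g : Fin k → Germ n) (s : ℕ) (x : Koszul n k (s + 1 + 1)) :
    koszulD g s (koszulD g (s + 1) x) = 0 := by
  obtain ⟨z, -, rfl⟩ := exists_koszulPull_eq x
  let h : ℕ → Germ n := fun j => if hj : j < k then g ⟨j, hj⟩ else 0
  have hg : ∀ j : Fin k, h j = g j := fun j => by simp [h]
  rw [koszulD_koszulPull hg, koszulD_koszulPull hg, kd_kd]
  rfl

theorem exists_koszulD_eq_of_codimGE {k c : ℕ} {f : Fin k → Germ n} (hf : CodimGE f c) {s : ℕ}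
    (hs : c ≤ s) (x : Koszul n k (s + 1)) (hx : koszulD f s x = 0) :
    ∃ y, koszulD f (s + 1) y = x := by
  obtain ⟨h, hh, hex⟩ := koszulExact_of_codimGE hf (Nat.lt_succ_of_le hs)
  obtain ⟨z, hz, rfl⟩ := exists_koszulPull_eq x
  rw [koszulD_koszulPull hh] at hx
  obtain ⟨y, -, hy⟩ := hex z hz (koszulPull_injOn (kd_mem hz) (Submodule.zero_mem _) hx)
  exact ⟨koszulPull _ y, by rw [koszulD_koszulPull hh, hy]⟩

end

section

variable {n r k : ℕ}

/-! ### Exactness of the filtered Koszul complex -/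

theorem pairing_add (v : Fin n → ℕ) (a b : Fin n →₀ ℕ) :
    pairing v (a + b) = pairing v a + pairing v b := by
  simp [pairing, mul_add, Finset.sum_add_distrib]

theorem pairing_mono (v : Fin n → ℕ) {a b : Fin n →₀ ℕ} (h : a ≤ b) :
    pairing v a ≤ pairing v b :=
  Finset.sum_le_sum fun i _ => Nat.mul_le_mul_left _ (h i)

theorem nuZ_le_pairing (p : Fin r → Fin n → ℕ) (f : Germ n) {q : Fin n →₀ ℕ} (hq : q ∈ supp f)
    (l : Fin r) : nuZ p f l ≤ pairing (p l) q :=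
  Nat.cast_le.2 (Nat.sInf_le ⟨q, hq, rfl⟩)

/-- The exponents whose weights for `j ∈ J` are prescribed by `μ`. -/
def levelSet (p : Fin r → Fin n → ℕ) (J : Finset (Fin r)) (μ : Fin r → ℤ) :
    Set (Fin n →₀ ℕ) :=
  {q | ∀ j ∈ J, (pairing (p j) q : ℤ) = μ j}

/-- The exponents with weights at least `μ`. -/
def upperSet (p : Fin r → Fin n → ℕ) (μ : Fin r → ℤ) : Set (Fin n →₀ ℕ) :=
  {q | ∀ l, μ l ≤ (pairing (p l) q : ℤ)}

theorem initialPart_eq_res (p : Fin r → Fin n → ℕ) (J : Finset (Fin r)) (f : Germ n) :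
    initialPart p J f = res (levelSet p J (nuZ p f)) f := by
  classical
  refine Germ.ext fun q => ?_
  have h : (∀ j ∈ J, pairing (p j) q = nu p f j) ↔ q ∈ levelSet p J (nuZ p f) :=
    forall₂_congr fun j _ => (Nat.cast_inj (R := ℤ)).symm
  rw [coeff_res, ← if_congr h rfl rfl]
  change (if ∀ j ∈ J, pairing (p j) q = nu p f j then coeff q f else 0) = _
  congr

theorem supp_initialPart_subset (p : Fin r → Fin n → ℕ) (J : Finset (Fin r)) (f : Germ n) :
    supp (initialPart p J f) ⊆ upperSet p (nuZ p f) ∩ levelSet p J (nuZ p f) := by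
  rw [initialPart_eq_res]
  exact fun q hq => ⟨nuZ_le_pairing p f (supp_res_subset_supp _ _ hq), supp_res_subset _ _ hq⟩

theorem initialPart_empty (p : Fin r → Fin n → ℕ) (f : Germ n) : initialPart p ∅ f = f := by
  rw [initialPart_eq_res]
  exact res_eq_self fun q _ j hj => absurd hj (Finset.notMem_empty j)

theorem initialPart_insert (p : Fin r → Fin n → ℕ) (J : Finset (Fin r)) (l : Fin r) (f : Germ n) :
    initialPart p (insert l J) f = res (levelSet p {l} (nuZ p f)) (initialPart p J f) := by
  classical
  rw [initialPart_eq_res, initialPart_eq_res]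
  refine Germ.ext fun q => ?_
  rw [coeff_res, coeff_res, coeff_res]
  simp only [levelSet, Finset.mem_insert, forall_eq_or_imp, Finset.mem_singleton, forall_eq,
    Set.mem_ofPred_eq]
  by_cases h1 : (pairing (p l) q : ℤ) = nuZ p f l
  · simp only [h1, true_and, if_true]
    congr
  · simp [h1]

/-- The shift of the summand indexed by `I` in the filtered Koszul complex. -/
def shift (p : Fin r → Fin n → ℕ) (g : Fin k → Germ n) (μ : Fin r → ℤ) (I : Finset (Fin k)) :
    Fin r → ℤ :=
  μ - ∑ i ∈ I, nuZ p (g i)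

theorem shift_eq_add (p : Fin r → Fin n → ℕ) (g : Fin k → Germ n) (μ : Fin r → ℤ)
    {I : Finset (Fin k)} {i : Fin k} (hi : i ∉ I) (l : Fin r) :
    shift p g μ I l = nuZ p (g i) l + shift p g μ (insert i I) l := by
  simp only [shift, Finset.sum_insert hi, Pi.sub_apply, Pi.add_apply]
  ring

theorem res_ksign_mul (C : Set (Fin n →₀ ℕ)) (I : Finset (Fin k)) (i : Fin k) (f : Germ n) :
    res C (ksign (Germ n) I i * f) = ksign (Germ n) I i * res C f := by
  unfold ksign
  rcases neg_one_pow_eq_or (Germ n) (I.filter (· < i)).card with h | h <;> simp [h]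

theorem supp_ksign_mul (I : Finset (Fin k)) (i : Fin k) (f : Germ n) :
    supp (ksign (Germ n) I i * f) = supp f := by
  unfold ksign
  rcases neg_one_pow_eq_or (Germ n) (I.filter (· < i)).card with h | h <;> simp [h, supp_neg]

/-- Truncation commutes with Koszul differentials. -/
theorem koszulD_res {f f' : Fin k → Germ n} {s : ℕ} {x : Koszul n k (s + 1)}
    (A : Fin k → Set (Fin n →₀ ℕ)) (B : Finset (Fin k) → Set (Fin n →₀ ℕ))
    (hf : ∀ i, f' i = res (A i) (f i))
    (h : ∀ I : {I : Finset (Fin k) // I.card = s}, ∀ i : {i : Fin k // i ∉ I.1},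
      ∀ a ∈ supp (f i),
      ∀ b ∈ supp (x ⟨insert i.1 I.1, by rw [Finset.card_insert_of_notMem i.2, I.2]⟩),
      a + b ∈ B I.1 ↔ a ∈ A i ∧ b ∈ B (insert i.1 I.1)) :
    koszulD f' s (fun I => res (B I.1) (x I)) = fun I => res (B I.1) (koszulD f s x I) := by
  ext1 I
  rw [koszulD_apply, koszulD_apply, map_sum]
  refine Finset.sum_congr rfl fun i _ => ?_
  rw [mul_assoc, mul_assoc, res_ksign_mul, hf, res_mul (h I i)]

/-- The part of the filtered Koszul complex that is homogeneous with respect to the weights in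
`J`. -/
def koszulLevel (p : Fin r → Fin n → ℕ) (g : Fin k → Germ n) (J : Finset (Fin r)) (μ : Fin r → ℤ)
    (s : ℕ) : Submodule ℂ (Koszul n k s) :=
  Submodule.pi Set.univ fun I => suppIn (upperSet p (shift p g μ I.1) ∩
    levelSet p J (shift p g μ I.1))

theorem mem_koszulLevel {p : Fin r → Fin n → ℕ} {g : Fin k → Germ n} {J : Finset (Fin r)}
    {μ : Fin r → ℤ} {s : ℕ} {x : Koszul n k s} :
    x ∈ koszulLevel p g J μ s ↔ ∀ I, supp (x I) ⊆ upperSet p (shift p g μ I.1) ∩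
      levelSet p J (shift p g μ I.1) := by
  simp only [koszulLevel, Submodule.mem_pi, Set.mem_univ, true_implies, mem_suppIn]

theorem koszulD_mem_koszulLevel {p : Fin r → Fin n → ℕ} {g : Fin k → Germ n} {J : Finset (Fin r)}
    {μ : Fin r → ℤ} {s : ℕ} {x : Koszul n k (s + 1)} (hx : x ∈ koszulLevel p g J μ (s + 1)) :
    koszulD (fun i => initialPart p J (g i)) s x ∈ koszulLevel p g J μ s := by
  rw [mem_koszulLevel] at *
  intro I
  rw [koszulD_apply]
  refine (suppIn _).sum_mem fun i _ => ?_
  rw [mem_suppIn, mul_assoc, supp_ksign_mul]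
  refine supp_mul_subset (supp_initialPart_subset p J (g i)) (hx _) ?_
  rintro a ⟨ha1, ha2⟩ b ⟨hb1, hb2⟩
  constructor
  · intro l
    rw [shift_eq_add p g μ i.2, pairing_add, Nat.cast_add]
    exact add_le_add (ha1 l) (hb1 l)
  · intro l hl
    rw [shift_eq_add p g μ i.2, pairing_add, Nat.cast_add, ha2 l hl, hb2 l hl]

/-- The homogeneous part of the filtered Koszul complex is exact in degrees above `#J`. -/
def KoszulLevelExact (p : Fin r → Fin n → ℕ) (g : Fin k → Germ n) (J : Finset (Fin r)) : Prop :=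
  ∀ s, J.card ≤ s → ∀ μ, ∀ x ∈ koszulLevel p g J μ (s + 1),
    koszulD (fun i => initialPart p J (g i)) s x = 0 →
    ∃ y ∈ koszulLevel p g J μ (s + 1 + 1), koszulD (fun i => initialPart p J (g i)) (s + 1) y = x

/-- The part of y of lowest l-weight has as differential the lowest part of x, which is 0. It is
therefore a boundary dw for the initial parts with respect to J ∪ {l}, and y minus the differential
of w for J has no terms of that weight left. -/
theorem exists_primitive_raise {p : Fin r → Fin n → ℕ} {g : Fin k → Germ n} {J : Finset (Fin r)}
    {l : Fin r} (hl : l ∉ J) (hex : KoszulLevelExact p g (insert l J)) {s : ℕ} (hs : J.card ≤ s)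
    {μ : Fin r → ℤ} {x : Koszul n k (s + 1)} (hx : x ∈ koszulLevel p g J (μ + Pi.single l 1) (s + 1))
    {y : Koszul n k (s + 1 + 1)} (hy : y ∈ koszulLevel p g J μ (s + 1 + 1))
    (hyx : koszulD (fun i => initialPart p J (g i)) (s + 1) y = x) :
    ∃ y' ∈ koszulLevel p g J (μ + Pi.single l 1) (s + 1 + 1),
      koszulD (fun i => initialPart p J (g i)) (s + 1) y' = x := by
  classical
  let trunc : ∀ {t : ℕ}, Koszul n k t → Koszul n k t := fun z I =>
    res (levelSet p {l} (shift p g μ I.1)) (z I)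
  have htrunc : ∀ {t : ℕ} {z : Koszul n k (t + 1)}, z ∈ koszulLevel p g J μ (t + 1) →
      koszulD (fun i => initialPart p (insert l J) (g i)) t (trunc z) =
        trunc (koszulD (fun i => initialPart p J (g i)) t z) := by
    intro t z hz
    rw [mem_koszulLevel] at hz
    refine koszulD_res (fun i => levelSet p {l} (nuZ p (g i)))
      (fun I => levelSet p {l} (shift p g μ I)) (fun i => initialPart_insert p J l (g i)) ?_
    -- Both l-weights are bounded below, so their sum attains the sum of the bounds exactly when
    -- each attains its own.
    intro I i a ha b hb
    have ha := (supp_initialPart_subset p J (g i) ha).1 l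
    have hb := (hz _ hb).1 l
    simp only [levelSet, Finset.mem_singleton, forall_eq, Set.mem_ofPred_eq, pairing_add,
      Nat.cast_add, shift_eq_add p g μ i.2] at *
    omega
  have htrunc_mem : trunc y ∈ koszulLevel p g (insert l J) μ (s + 1 + 1) := by
    rw [mem_koszulLevel] at *
    intro I q hq
    have h1 := hy I (supp_res_subset_supp _ _ hq)
    have h2 := supp_res_subset _ _ hq
    refine ⟨h1.1, fun j hj => ?_⟩
    rcases Finset.mem_insert.1 hj with rfl | hj
    · exact h2 j (Finset.mem_singleton_self j)
    · exact h1.2 j hj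
  have htrunc_x : trunc x = 0 := by
    ext1 I
    refine res_eq_zero fun q hq hq' => ?_
    have h1 := (mem_koszulLevel.1 hx I hq).1 l
    have h2 := hq' l (Finset.mem_singleton_self l)
    simp only [shift, Pi.sub_apply, Pi.add_apply, Pi.single_eq_same] at h1 h2
    omega
  -- Enlarging J costs one degree, but y lives one degree above x, so the bound is preserved.
  obtain ⟨w, hw, hdw⟩ := hex (s + 1) (by rw [Finset.card_insert_of_notMem hl]; omega) μ _ htrunc_mem
    (by rw [htrunc hy, hyx, htrunc_x])
  have hwJ : w ∈ koszulLevel p g J μ (s + 1 + 1 + 1) := by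
    rw [mem_koszulLevel] at *
    exact fun I q hq => ⟨(hw I hq).1, fun j hj => (hw I hq).2 j (Finset.mem_insert_of_mem hj)⟩
  have hwtrunc : trunc w = w := by
    ext1 I
    exact res_eq_self fun q hq j hj => (mem_koszulLevel.1 hw I hq).2 j
      (Finset.mem_singleton.1 hj ▸ Finset.mem_insert_self _ _)
  set y' := y - koszulD (fun i => initialPart p J (g i)) (s + 1 + 1) w
  have hy'0 : trunc y' = 0 := by
    have h1 : trunc y' = trunc y - trunc (koszulD (fun i => initialPart p J (g i)) (s + 1 + 1) w) :=
      funext fun I => map_sub _ _ _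
    rw [h1, ← htrunc hwJ, hwtrunc, hdw, sub_self]
  have hy'mem : y' ∈ koszulLevel p g J μ (s + 1 + 1) :=
    Submodule.sub_mem _ hy (koszulD_mem_koszulLevel hwJ)
  refine ⟨y', ?_, by rw [map_sub, koszulD_koszulD, sub_zero, hyx]⟩
  rw [mem_koszulLevel] at *
  intro I q hq
  have h1 := hy'mem I hq
  have hne : (pairing (p l) q : ℤ) ≠ shift p g μ I.1 l := by
    intro he
    apply hq
    have h2 : coeff q (trunc y' I) = 0 := by rw [hy'0]; rfl
    rwa [coeff_res, if_pos] at h2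
    intro j hj
    rw [Finset.mem_singleton.1 hj, he]
  constructor
  · intro j
    have h3 := h1.1 j
    by_cases hj : j = l
    · subst hj
      simp only [shift, Pi.sub_apply, Pi.add_apply, Pi.single_eq_same] at h3 hne ⊢
      omega
    · simpa [shift, hj] using h3
  · intro j hj
    have h3 := h1.2 j hj
    have hjl : j ≠ l := fun h => hl (h ▸ hj)
    simpa [shift, hjl] using h3

/-- Induction on the total defect N = ∑ (μ_l - μ'_l). Coordinates in J have no defect, so only those
outside J are raised. -/
theorem exists_primitive_of_le {p : Fin r → Fin n → ℕ} {g : Fin k → Germ n} {J : Finset (Fin r)}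
    (hex : ∀ l ∉ J, KoszulLevelExact p g (insert l J)) {s : ℕ} (hs : J.card ≤ s)
    {μ : Fin r → ℤ} {x : Koszul n k (s + 1)} (hx : x ∈ koszulLevel p g J μ (s + 1)) (N : ℕ) :
    ∀ μ' : Fin r → ℤ, μ' ≤ μ → (∀ j ∈ J, μ' j = μ j) → ∑ l, (μ l - μ' l) = N →
      (∃ y ∈ koszulLevel p g J μ' (s + 1 + 1),
        koszulD (fun i => initialPart p J (g i)) (s + 1) y = x) →
      ∃ y ∈ koszulLevel p g J μ (s + 1 + 1),
        koszulD (fun i => initialPart p J (g i)) (s + 1) y = x := by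
  classical
  induction N with
  | zero =>
    intro μ' hle _ hsum hy
    have h0 := (Finset.sum_eq_zero_iff_of_nonneg fun l _ => sub_nonneg.2 (hle l)).1 hsum
    have : μ' = μ := funext fun l => (sub_eq_zero.1 (h0 l (Finset.mem_univ l))).symm
    exact this ▸ hy
  | succ N ih =>
    rintro μ' hle hJ hsum ⟨y, hy, hyx⟩
    obtain ⟨l, hl⟩ : ∃ l, μ' l < μ l := by
      by_contra! hcon
      have : ∑ l, (μ l - μ' l) ≤ 0 := Finset.sum_nonpos fun l _ => sub_nonpos.2 (hcon l)
      rw [hsum] at this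
      push_cast at this
      omega
    have hlJ : l ∉ J := fun h => hl.ne (hJ l h)
    have hle' : μ' + Pi.single l 1 ≤ μ := by
      intro j
      by_cases hj : j = l
      · subst hj
        simp only [Pi.add_apply, Pi.single_eq_same]
        omega
      · simpa [hj] using hle j
    have hJ' : ∀ j ∈ J, (μ' + Pi.single l 1 : Fin r → ℤ) j = μ j := by
      intro j hj
      have hjl : j ≠ l := fun h => hlJ (h ▸ hj)
      simpa [hjl] using hJ j hj
    refine ih (μ' + Pi.single l 1) hle' hJ' ?_
      (exists_primitive_raise hlJ (hex l hlJ) hs ?_ hy hyx)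
    · have h1 : ∑ j, (μ j - (μ' + Pi.single l 1 : Fin r → ℤ) j) = ∑ j, (μ j - μ' j) - 1 := by
        simp only [Pi.add_apply, Finset.sum_sub_distrib, Finset.sum_add_distrib,
          Finset.sum_pi_single', Finset.mem_univ, if_true]
        ring
      rw [h1, hsum]
      push_cast
      ring
    · rw [mem_koszulLevel] at *
      intro I q hq
      obtain ⟨h1, h2⟩ := hx I hq
      refine ⟨fun j => ?_, fun j hj => ?_⟩
      · exact (sub_le_sub_right (hle' j) _).trans (h1 j)
      · rw [h2 j hj]
        simp only [shift, Pi.sub_apply, hJ' j hj]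

theorem koszulLevelExact_of_insert {p : Fin r → Fin n → ℕ} {g : Fin k → Germ n}
    {J : Finset (Fin r)} (hin : CodimGE (fun i => initialPart p J (g i)) J.card)
    (hex : ∀ l ∉ J, KoszulLevelExact p g (insert l J)) : KoszulLevelExact p g J := by
  classical
  intro s hs μ x hx hdx
  obtain ⟨y, hy⟩ := exists_koszulD_eq_of_codimGE hin hs x hdx
  -- Outside J the bounds μ' - ∑ ν_i are at most 0 and hence empty conditions, so the only
  -- requirement is homogeneity in J. Truncation to the J-level achieves it and commutes with the
  -- differential, the initial parts being J-homogeneous.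
  let μ' : Fin r → ℤ := fun l => if l ∈ J then μ l else min (μ l) 0
  have hJ : ∀ j ∈ J, μ' j = μ j := fun j hj => if_pos hj
  have hle : μ' ≤ μ := by
    intro l
    simp only [μ']
    split_ifs
    · exact le_rfl
    · exact min_le_left _ _
  refine exists_primitive_of_le hex hs hx (∑ l, (μ l - μ' l)).toNat μ' hle hJ
    (Int.toNat_of_nonneg (Finset.sum_nonneg fun l _ => sub_nonneg.2 (hle l))).symm
    ⟨fun I => res (levelSet p J (shift p g μ I.1)) (y I), ?_, ?_⟩
  · rw [mem_koszulLevel]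
    intro I q hq
    have hq := supp_res_subset _ _ hq
    have hlev : ∀ j ∈ J, (pairing (p j) q : ℤ) = shift p g μ' I.1 j := by
      intro j hj
      rw [hq j hj]
      simp only [shift, Pi.sub_apply, hJ j hj]
    refine ⟨fun l => ?_, hlev⟩
    by_cases hl : l ∈ J
    · exact (hlev l hl).ge
    · have h1 : μ' l ≤ 0 := by simp only [μ', if_neg hl, min_le_right]
      have h2 : 0 ≤ (∑ i ∈ I.1, nuZ p (g i)) l := by
        rw [Finset.sum_apply]
        exact Finset.sum_nonneg fun i _ => Nat.cast_nonneg _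
      simp only [shift, Pi.sub_apply]
      omega
  · rw [koszulD_res (f := fun i => initialPart p J (g i)) (fun _ => Set.univ)
      (fun I => levelSet p J (shift p g μ I)) (fun i => (res_eq_self (Set.subset_univ _)).symm), hy]
    · ext1 I
      exact res_eq_self fun q hq => (mem_koszulLevel.1 hx I hq).2
    · intro I i a ha b _
      have ha := (supp_initialPart_subset p J (g i) ha).2
      simp only [Set.mem_univ, true_and]
      refine forall₂_congr fun j hj => ?_
      rw [pairing_add, Nat.cast_add, ha j hj, shift_eq_add p g μ i.2]
      exact add_right_inj _

theorem koszulLevelExact {p : Fin r → Fin n → ℕ} {g : Fin k → Germ n}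
    (hin : ∀ J : Finset (Fin r), CodimGE (fun i => initialPart p J (g i)) J.card)
    (J : Finset (Fin r)) : KoszulLevelExact p g J := by
  suffices H : ∀ N, ∀ J : Finset (Fin r), r ≤ J.card + N → KoszulLevelExact p g J from
    H r J (Nat.le_add_left _ _)
  intro N
  induction N with
  | zero =>
    intro J hJ
    refine koszulLevelExact_of_insert (hin J) fun l hl => absurd ?_ hl
    have : J = Finset.univ := (Finset.card_eq_iff_eq_univ J).1
      (le_antisymm (Finset.card_le_univ J) (by simpa using hJ))
    simp [this]
  | succ N ih =>
    intro J hJ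
    refine koszulLevelExact_of_insert (hin J) fun l hl => ih _ ?_
    rw [Finset.card_insert_of_notMem hl]
    omega

/-! ### The case J = ∅: the filtered Koszul complex itself -/

theorem mem_F_iff {p : Fin r → Fin n → ℕ} {μ : Fin r → ℤ} {f : Germ n} :
    f ∈ F p μ ↔ supp f ⊆ upperSet p μ := by
  rw [F, mem_span_zmon_iff]
  refine forall₂_congr fun q _ => ⟨?_, fun h => ⟨q, h, le_rfl⟩⟩
  rintro ⟨a, ha, hle⟩ l
  exact (ha l).trans (Nat.cast_le.2 (pairing_mono (p l) hle))

theorem mem_koszulF_iff {p : Fin r → Fin n → ℕ} {g : Fin k → Germ n} {μ : Fin r → ℤ} {s : ℕ}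
    {x : Koszul n k s} : x ∈ koszulF p g μ s ↔ x ∈ koszulLevel p g ∅ μ s := by
  rw [mem_koszulLevel, koszulF, Submodule.mem_pi]
  refine forall_congr' fun I => ?_
  rw [mem_F_iff]
  simp [levelSet, shift]

theorem koszulD_mem_koszulF (p : Fin r → Fin n → ℕ) (g : Fin k → Germ n) (μ : Fin r → ℤ) (s : ℕ)
    (x : Koszul n k (s + 1)) (hx : x ∈ koszulF p g μ (s + 1)) : koszulD g s x ∈ koszulF p g μ s := by
  rw [mem_koszulF_iff] at *
  simpa only [initialPart_empty] using koszulD_mem_koszulLevel hx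

theorem codimGE_initialPart {p : Fin r → Fin n → ℕ} {g : Fin k → Germ n}
    (hci : IsCompleteIntersection g)
    (hin : ∀ J : Finset (Fin r), J.Nonempty → CodimGE (fun i => initialPart p J (g i)) J.card)
    (J : Finset (Fin r)) : CodimGE (fun i => initialPart p J (g i)) J.card := by
  rcases J.eq_empty_or_nonempty with rfl | hJ
  · rw [show (fun i => initialPart p ∅ (g i)) = g from funext fun i => initialPart_empty p (g i)]
    exact hci.2.le
  · exact hin J hJ

theorem exists_koszulF_primitive {p : Fin r → Fin n → ℕ} {g : Fin k → Germ n}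
    (hin : ∀ J : Finset (Fin r), CodimGE (fun i => initialPart p J (g i)) J.card) (μ : Fin r → ℤ)
    (s : ℕ) (x : Koszul n k (s + 1)) (hx : x ∈ koszulF p g μ (s + 1)) (hdx : koszulD g s x = 0) :
    ∃ y ∈ koszulF p g μ (s + 1 + 1), koszulD g (s + 1) y = x := by
  have := koszulLevelExact hin ∅ s (Nat.zero_le _) μ x (mem_koszulF_iff.1 hx)
  simp only [initialPart_empty] at this
  obtain ⟨y, hy, h⟩ := this hdx
  exact ⟨y, mem_koszulF_iff.2 hy, h⟩

theorem mem_relIdeal_iff {p : Fin r → Fin n → ℕ} {g : Fin k → Germ n} {μ : Fin r → ℤ}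
    {f : Germ n} : f ∈ relIdeal p g μ ↔
      ∃ x ∈ koszulF p g μ 1, koszulD g 0 x ⟨∅, Finset.card_empty⟩ = f := by
  classical
  let φ : Koszul n k 1 →ₗ[Germ n] Germ n := (LinearMap.proj (R := Germ n) (φ := fun _ => Germ n)
    (⟨∅, Finset.card_empty⟩ : {I : Finset (Fin k) // I.card = 0})).comp (koszulD g 0)
  suffices relIdeal p g μ = (koszulF p g μ 1).map φ by rw [this]; rfl
  refine le_antisymm (iSup_le fun i => ?_) ?_
  · intro x hx
    obtain ⟨z, hz, rfl⟩ := Ideal.mem_span_singleton_mul.1 hx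
    refine ⟨Pi.single ⟨{i}, Finset.card_singleton i⟩ z, ?_, ?_⟩
    · rw [SetLike.mem_coe, koszulF, Submodule.mem_pi]
      intro I _
      by_cases hI : I = ⟨{i}, Finset.card_singleton i⟩
      · subst hI
        simpa using hz
      · rw [Pi.single_eq_of_ne hI]
        exact Submodule.zero_mem _
    · change koszulD g 0 _ _ = _
      rw [koszulD_apply, Finset.sum_eq_single ⟨i, Finset.notMem_empty i⟩]
      · simp [ksign]
      · rintro ⟨j, hj⟩ _ hne
        rw [Pi.single_eq_of_ne, mul_zero]
        intro h
        simp only [Subtype.mk.injEq, LawfulSingleton.insert_empty_eq, Finset.singleton_inj] at h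
        exact hne (Subtype.ext h)
      · simp
  · rintro _ ⟨x, hx, rfl⟩
    change koszulD g 0 x _ ∈ _
    rw [koszulD_apply]
    refine Submodule.sum_mem _ fun i _ => ?_
    rw [mul_assoc]
    refine Ideal.mul_mem_left _ _ (Submodule.mem_iSup_of_mem i.1
      (Ideal.mul_mem_mul (Ideal.mem_span_singleton_self _) ?_))
    rw [SetLike.mem_coe, koszulF, Submodule.mem_pi] at hx
    simpa using hx ⟨insert i.1 ∅, by simp⟩ (Set.mem_univ _)

end

section

variable {n r k : ℕ}

/-! ### Dimensions -/

section Rank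

variable (K : Type*) {R : Type*} [Field K] [CommRing R] [Algebra K R]

/-- Additivity of dimension in a short exact sequence `X₁ → X₂ → X₃` that is presented by
surjections `B → X₁`, `A → X₂`, `A → X₃`. -/
theorem finrank_of_presentation {A B X₁ X₂ X₃ : Type*}
    [AddCommGroup A] [Module R A] [AddCommGroup B] [Module R B]
    [AddCommGroup X₁] [Module R X₁] [Module K X₁] [IsScalarTower K R X₁]
    [AddCommGroup X₂] [Module R X₂] [Module K X₂] [IsScalarTower K R X₂]
    [AddCommGroup X₃] [Module R X₃] [Module K X₃] [IsScalarTower K R X₃]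
    (ι : B →ₗ[R] A) (π₁ : B →ₗ[R] X₁) (π₂ : A →ₗ[R] X₂) (π₃ : A →ₗ[R] X₃)
    (hπ₁ : Function.Surjective π₁) (hπ₂ : Function.Surjective π₂) (hπ₃ : Function.Surjective π₃)
    (h₁ : ∀ b, π₁ b = 0 ↔ π₂ (ι b) = 0) (h₂ : ∀ b, π₃ (ι b) = 0)
    (h₃ : ∀ a, π₃ a = 0 → ∃ b, π₂ (a - ι b) = 0) (h₄ : ∀ a, π₂ a = 0 → π₃ a = 0)
    [Module.Finite K X₂] :
    Module.Finite K X₁ ∧ Module.Finite K X₃ ∧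
      Module.finrank K X₂ = Module.finrank K X₁ + Module.finrank K X₃ := by
  let f : X₁ →ₗ[R] X₂ := (LinearMap.ker π₁).liftQ (π₂.comp ι) (fun b hb => (h₁ b).1 hb) ∘ₗ
    (π₁.quotKerEquivOfSurjective hπ₁).symm.toLinearMap
  let g : X₂ →ₗ[R] X₃ := (LinearMap.ker π₂).liftQ π₃ (fun a ha => h₄ a ha) ∘ₗ
    (π₂.quotKerEquivOfSurjective hπ₂).symm.toLinearMap
  have hf : ∀ b, f (π₁ b) = π₂ (ι b) := by
    intro b
    have : (π₁.quotKerEquivOfSurjective hπ₁).symm (π₁ b) = Submodule.Quotient.mk b := by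
      rw [LinearEquiv.symm_apply_eq]; rfl
    simp only [f, LinearMap.comp_apply, LinearEquiv.coe_coe, this]
    rfl
  have hg : ∀ a, g (π₂ a) = π₃ a := by
    intro a
    have : (π₂.quotKerEquivOfSurjective hπ₂).symm (π₂ a) = Submodule.Quotient.mk a := by
      rw [LinearEquiv.symm_apply_eq]; rfl
    simp only [g, LinearMap.comp_apply, LinearEquiv.coe_coe, this]
    rfl
  have hfinj : Function.Injective (f.restrictScalars K) := by
    rw [← LinearMap.ker_eq_bot, LinearMap.ker_eq_bot']
    intro x hx
    obtain ⟨b, rfl⟩ := hπ₁ x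
    exact (h₁ b).2 ((hf b).symm.trans hx)
  have hgsurj : Function.Surjective (g.restrictScalars K) := by
    intro x
    obtain ⟨a, rfl⟩ := hπ₃ x
    exact ⟨π₂ a, hg a⟩
  have hrange : LinearMap.ker (g.restrictScalars K) = LinearMap.range (f.restrictScalars K) := by
    ext x
    obtain ⟨a, rfl⟩ := hπ₂ x
    rw [LinearMap.mem_ker, LinearMap.mem_range]
    constructor
    · intro h
      obtain ⟨b, hb⟩ := h₃ a ((hg a).symm.trans h)
      rw [map_sub, sub_eq_zero] at hb
      exact ⟨π₁ b, (hf b).trans hb.symm⟩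
    · rintro ⟨y, hy⟩
      obtain ⟨b, rfl⟩ := hπ₁ y
      rw [← hy]
      change g (f (π₁ b)) = 0
      rw [hf, hg, h₂]
  refine ⟨Module.Finite.of_injective _ hfinj, Module.Finite.of_surjective _ hgsurj, ?_⟩
  rw [← (g.restrictScalars K).finrank_range_add_finrank_ker, hrange,
    LinearMap.finrank_range_of_inj hfinj, LinearMap.range_eq_top.2 hgsurj, finrank_top, add_comm]

/-- The dimension of a quotient that is presented by linear functionals. -/
theorem finrank_quotient_of_functionals {A T : Type*} [Finite T] [AddCommGroup A] [Module R A]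
    [Module K A] [IsScalarTower K R A] (N : Submodule R A) (φ : A →ₗ[K] (T → K))
    (hφ : Function.Surjective φ) (hN : ∀ a, a ∈ N ↔ φ a = 0) :
    Module.Finite K (A ⧸ N) ∧ Module.finrank K (A ⧸ N) = Nat.card T := by
  have := Fintype.ofFinite T
  have hker : N.restrictScalars K = LinearMap.ker φ := by
    ext a
    rw [Submodule.restrictScalars_mem, hN, LinearMap.mem_ker]
  let e : (A ⧸ N) ≃ₗ[K] (T → K) := (Submodule.Quotient.restrictScalarsEquiv K N).symm ≪≫ₗ
    Submodule.quotEquivOfEq _ _ hker ≪≫ₗ φ.quotKerEquivOfSurjective hφ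
  refine ⟨Module.Finite.equiv e.symm, ?_⟩
  rw [e.finrank_eq, Module.finrank_fintype_fun_eq_card, Nat.card_eq_fintype_card]

end Rank

/-- The exponents that occur in `F_μ` but not in `F_{μ+𝟏}`. -/
def layer (p : Fin r → Fin n → ℕ) (μ : Fin r → ℤ) : Set (Fin n →₀ ℕ) :=
  upperSet p μ \ upperSet p (μ + 1)

theorem finite_pairing_le {v : Fin n → ℕ} (hv : ∀ i, 0 < v i) (M : ℤ) :
    {q : Fin n →₀ ℕ | (pairing v q : ℤ) ≤ M}.Finite := by
  refine (Set.finite_Iic (Finsupp.equivFunOnFinite.symm fun _ => M.toNat)).subset fun q hq i => ?_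
  have h1 : q i ≤ v i * q i := Nat.le_mul_of_pos_left _ (hv i)
  have h2 : v i * q i ≤ pairing v q :=
    Finset.single_le_sum (f := fun i => v i * q i) (fun _ _ => Nat.zero_le _) (Finset.mem_univ i)
  have hq : (pairing v q : ℤ) ≤ M := hq
  change q i ≤ M.toNat
  omega

theorem finite_layer {p : Fin r → Fin n → ℕ} (hp : ∀ l i, 0 < p l i) (μ : Fin r → ℤ) :
    (layer p μ).Finite := by
  refine (Set.finite_iUnion fun l => finite_pairing_le (hp l) (μ l)).subset ?_
  rintro q ⟨-, hq⟩
  rw [upperSet, Set.mem_ofPred_eq, not_forall] at hq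
  obtain ⟨l, hl⟩ := hq
  rw [Pi.add_apply, Pi.one_apply, not_le] at hl
  exact Set.mem_iUnion.2 ⟨l, by change (pairing (p l) q : ℤ) ≤ μ l; omega⟩

/-- The coefficients at exponents of the layer are independent functionals on F_μ with common kernel
F_{μ+𝟏}. -/
theorem finrank_F_layer {p : Fin r → Fin n → ℕ} (hp : ∀ l i, 0 < p l i) (μ : Fin r → ℤ) :
    Module.Finite ℂ (F p μ ⧸ Submodule.comap (F p μ).subtype (F p (μ + 1))) ∧
      Module.finrank ℂ (F p μ ⧸ Submodule.comap (F p μ).subtype (F p (μ + 1))) =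
        Nat.card (layer p μ) := by
  classical
  have := (finite_layer hp μ).to_subtype
  have := Fintype.ofFinite (layer p μ)
  let φ : F p μ →ₗ[ℂ] (layer p μ → ℂ) := LinearMap.pi fun q => (coeffL q.1).comp
    ((F p μ).subtype.restrictScalars ℂ)
  refine finrank_quotient_of_functionals ℂ _ φ ?_ ?_
  · intro c
    refine ⟨⟨∑ q : layer p μ, c q • zmon q.1, mem_F_iff.2 ?_⟩, ?_⟩
    · refine (suppIn (upperSet p μ)).sum_mem fun q _ => Submodule.smul_mem _ _ ?_
      intro m hm
      rw [mem_supp, coeff_zmon] at hm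
      have : m = q.1 := by by_contra h; exact hm (if_neg h)
      exact this ▸ q.2.1
    · ext q
      change coeff q.1 (∑ q : layer p μ, c q • zmon q.1) = c q
      rw [coeff_sum, Finset.sum_eq_single q]
      · simp [coeff_zmon]
      · intro m _ hm
        rw [coeff_smul, coeff_zmon, if_neg (fun h => hm (Subtype.ext h.symm)), mul_zero]
      · simp
  · rintro ⟨f, hf⟩
    rw [mem_F_iff] at hf
    rw [Submodule.mem_comap, Submodule.subtype_apply, mem_F_iff]
    constructor
    · intro h
      ext q
      by_contra hne
      exact q.2.2 (h hne)
    · intro h q hq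
      by_contra hq'
      exact hq (congrFun h ⟨q, hf hq, hq'⟩)

theorem shift_add_one (p : Fin r → Fin n → ℕ) (g : Fin k → Germ n) (μ : Fin r → ℤ)
    (I : Finset (Fin k)) : shift p g (μ + 1) I = shift p g μ I + 1 := by
  simp only [shift]
  abel

theorem mem_koszulF {p : Fin r → Fin n → ℕ} {g : Fin k → Germ n} {μ : Fin r → ℤ} {s : ℕ}
    {x : Koszul n k s} :
    x ∈ koszulF p g μ s ↔ ∀ I, supp (x I) ⊆ upperSet p (shift p g μ I.1) := by
  rw [koszulF, Submodule.mem_pi]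
  exact forall_congr' fun I => by rw [mem_F_iff]; simp [shift]

theorem koszulF_anti (p : Fin r → Fin n → ℕ) (g : Fin k → Germ n) (μ : Fin r → ℤ) (s : ℕ) :
    koszulF p g (μ + 1) s ≤ koszulF p g μ s := fun _ hx I hI =>
  F_anti p (sub_le_sub_right (le_add_of_nonneg_right zero_le_one) _) (hx I hI)

theorem finrank_koszulF_layer {p : Fin r → Fin n → ℕ} (hp : ∀ l i, 0 < p l i) (g : Fin k → Germ n)
    (μ : Fin r → ℤ) (s : ℕ) :
    Module.Finite ℂ (koszulF p g μ s ⧸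
        Submodule.comap (koszulF p g μ s).subtype (koszulF p g (μ + 1) s)) ∧
      Module.finrank ℂ (koszulF p g μ s ⧸
        Submodule.comap (koszulF p g μ s).subtype (koszulF p g (μ + 1) s)) =
        ∑ I : {I : Finset (Fin k) // I.card = s}, Nat.card (layer p (shift p g μ I.1)) := by
  classical
  have hfin : ∀ I : {I : Finset (Fin k) // I.card = s}, Finite (layer p (shift p g μ I.1)) :=
    fun I => (finite_layer hp _).to_subtype
  let T := Σ I : {I : Finset (Fin k) // I.card = s}, layer p (shift p g μ I.1)
  rw [← Nat.card_sigma]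
  have := fun I : {I : Finset (Fin k) // I.card = s} =>
    Fintype.ofFinite (layer p (shift p g μ I.1))
  let φ : koszulF p g μ s →ₗ[ℂ] (T → ℂ) := LinearMap.pi fun t => (coeffL t.2.1).comp
    ((LinearMap.proj (R := ℂ) (φ := fun _ => Germ n) t.1).comp
      ((koszulF p g μ s).subtype.restrictScalars ℂ))
  refine finrank_quotient_of_functionals ℂ _ φ ?_ ?_
  · intro c
    refine ⟨⟨fun I => ∑ q : layer p (shift p g μ I.1), c ⟨I, q⟩ • zmon q.1,
      mem_koszulF.2 fun I => ?_⟩, ?_⟩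
    · refine (suppIn (upperSet p (shift p g μ I.1))).sum_mem fun q _ => Submodule.smul_mem _ _ ?_
      intro m hm
      rw [mem_supp, coeff_zmon] at hm
      have : m = q.1 := by by_contra h; exact hm (if_neg h)
      exact this ▸ q.2.1
    · ext ⟨I, q⟩
      change coeff q.1 (∑ q : layer p (shift p g μ I.1), c ⟨I, q⟩ • zmon q.1) = c ⟨I, q⟩
      rw [coeff_sum, Finset.sum_eq_single q]
      · simp [coeff_zmon]
      · intro m _ hm
        rw [coeff_smul, coeff_zmon, if_neg (fun h => hm (Subtype.ext h.symm)), mul_zero]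
      · simp
  · rintro ⟨x, hx⟩
    rw [mem_koszulF] at hx
    rw [Submodule.mem_comap, Submodule.subtype_apply, mem_koszulF]
    simp only [shift_add_one]
    constructor
    · intro h
      ext ⟨I, q⟩
      by_contra hne
      exact q.2.2 (h I hne)
    · intro h I q hq
      by_contra hq'
      exact hq (congrFun h ⟨I, q, hx I hq, hq'⟩)

/-- The elements of `koszulF μ (s + 1)` with the same differential as an element of
`koszulF (μ + 1) (s + 1)`. -/
def boundaryKer (p : Fin r → Fin n → ℕ) (g : Fin k → Germ n) (μ : Fin r → ℤ) (s : ℕ) :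
    Submodule (Germ n) (koszulF p g μ (s + 1)) :=
  ((koszulF p g (μ + 1) (s + 1)).map (koszulD g s)).comap
    ((koszulD g s).comp (koszulF p g μ (s + 1)).subtype)

theorem mem_boundaryKer {p : Fin r → Fin n → ℕ} {g : Fin k → Germ n} {μ : Fin r → ℤ} {s : ℕ}
    {x : koszulF p g μ (s + 1)} : x ∈ boundaryKer p g μ s ↔
      ∃ y ∈ koszulF p g (μ + 1) (s + 1), koszulD g s y = koszulD g s x.1 := Iff.rfl

/-- The dimension of the quotient of the boundaries in degree `s` for `μ` by those for `μ + 𝟏`. -/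
def boundaryDim (p : Fin r → Fin n → ℕ) (g : Fin k → Germ n) (μ : Fin r → ℤ) (s : ℕ) : ℕ :=
  Module.finrank ℂ (koszulF p g μ (s + 1) ⧸ boundaryKer p g μ s)

/-- With B_s the boundaries in degree s, exactness gives 0 → B_{s+1} → K_{s+1} → B_s → 0 for both μ
and μ + 𝟏. The quotients of the first sequence by the second again form a short exact sequence. -/
theorem finrank_koszulF_eq_boundaryDim {p : Fin r → Fin n → ℕ} (hp : ∀ l i, 0 < p l i)
    {g : Fin k → Germ n}
    (hin : ∀ J : Finset (Fin r), CodimGE (fun i => initialPart p J (g i)) J.card)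
    (μ : Fin r → ℤ) (s : ℕ) :
    Module.Finite ℂ (koszulF p g μ (s + 1) ⧸ boundaryKer p g μ s) ∧
      ∑ I : {I : Finset (Fin k) // I.card = s + 1}, Nat.card (layer p (shift p g μ I.1)) =
        boundaryDim p g μ (s + 1) + boundaryDim p g μ s := by
  obtain ⟨hfin, hcard⟩ := finrank_koszulF_layer hp g μ (s + 1)
  rw [← hcard]
  let ι : koszulF p g μ (s + 1 + 1) →ₗ[Germ n] koszulF p g μ (s + 1) :=
    (koszulD g (s + 1)).restrict (koszulD_mem_koszulF p g μ (s + 1))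
  refine (finrank_of_presentation ℂ ι (Submodule.mkQ (boundaryKer p g μ (s + 1)))
    (Submodule.mkQ _) (Submodule.mkQ (boundaryKer p g μ s)) (Submodule.mkQ_surjective _)
    (Submodule.mkQ_surjective _) (Submodule.mkQ_surjective _) ?_ ?_ ?_ ?_).2
  all_goals simp only [Submodule.mkQ_apply, Submodule.Quotient.mk_eq_zero, mem_boundaryKer,
    Submodule.mem_comap, Submodule.subtype_apply]
  · rintro ⟨b, hb⟩
    change _ ↔ koszulD g (s + 1) b ∈ _
    constructor
    · rintro ⟨y, hy, h⟩
      exact h ▸ koszulD_mem_koszulF p g _ _ y hy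
    · intro h
      exact exists_koszulF_primitive hin (μ + 1) s _ h (koszulD_koszulD g s b)
  · rintro ⟨b, hb⟩
    refine ⟨0, Submodule.zero_mem _, ?_⟩
    rw [map_zero]
    exact (koszulD_koszulD g s b).symm
  · rintro ⟨a, ha⟩ ⟨y, hy, h⟩
    obtain ⟨b, hb, hdb⟩ := exists_koszulF_primitive hin μ s (a - y)
      (Submodule.sub_mem _ ha (koszulF_anti p g μ _ hy)) (by rw [map_sub, sub_eq_zero]; exact h.symm)
    refine ⟨⟨b, hb⟩, ?_⟩
    change a - koszulD g (s + 1) b ∈ _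
    rw [hdb, sub_sub_cancel]
    exact hy
  · rintro ⟨a, ha⟩ h
    exact ⟨a, h, rfl⟩

theorem boundaryDim_eq_zero (p : Fin r → Fin n → ℕ) (g : Fin k → Germ n) (μ : Fin r → ℤ) {s : ℕ}
    (hs : k ≤ s) : boundaryDim p g μ s = 0 := by
  have : IsEmpty {I : Finset (Fin k) // I.card = s + 1} := by
    refine ⟨fun I => ?_⟩
    have := I.1.card_le_univ
    rw [I.2, Fintype.card_fin] at this
    omega
  exact Module.finrank_zero_of_subsingleton

theorem sum_range_boundaryDim {p : Fin r → Fin n → ℕ} (hp : ∀ l i, 0 < p l i)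
    {g : Fin k → Germ n}
    (hin : ∀ J : Finset (Fin r), CodimGE (fun i => initialPart p J (g i)) J.card)
    (μ : Fin r → ℤ) (N : ℕ) :
    (boundaryDim p g μ 0 : ℤ) = ∑ s ∈ Finset.range N, (-1) ^ s *
      ((∑ I : {I : Finset (Fin k) // I.card = s + 1}, Nat.card (layer p (shift p g μ I.1)) : ℕ) : ℤ)
      + (-1) ^ N * boundaryDim p g μ N := by
  induction N with
  | zero => simp
  | succ N ih =>
    rw [ih, Finset.sum_range_succ, (finrank_koszulF_eq_boundaryDim hp hin μ N).2]
    push_cast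
    ring

theorem augmentation_eq_zero_iff {p : Fin r → Fin n → ℕ} {g : Fin k → Germ n} {μ : Fin r → ℤ}
    {x : koszulF p g μ 0} :
    augmentation p g μ x = 0 ↔ x.1 ⟨∅, Finset.card_empty⟩ ∈ relIdeal p g μ := by
  rw [augmentation, LinearMap.comp_apply, Submodule.mkQ_apply, Submodule.Quotient.mk_eq_zero]
  rfl

theorem augmentation_surjective (p : Fin r → Fin n → ℕ) (g : Fin k → Germ n) (μ : Fin r → ℤ) :
    Function.Surjective (augmentation p g μ) := by
  intro y
  obtain ⟨⟨f, hf⟩, rfl⟩ := Submodule.mkQ_surjective _ y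
  refine ⟨⟨fun _ => f, mem_koszulF.2 fun I => ?_⟩, rfl⟩
  have hI : I.1 = ∅ := Finset.card_eq_zero.1 I.2
  rw [hI, shift, Finset.sum_empty, sub_zero]
  exact mem_F_iff.1 hf

theorem relIdeal_le_F (p : Fin r → Fin n → ℕ) (g : Fin k → Germ n) (μ : Fin r → ℤ) :
    relIdeal p g μ ≤ F p μ := by
  intro f hf
  obtain ⟨x, hx, rfl⟩ := mem_relIdeal_iff.1 hf
  have := koszulD_mem_koszulF p g μ 0 x hx ⟨∅, Finset.card_empty⟩ (Set.mem_univ _)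
  simpa using this

theorem koszulD_zero_eq_iff {g : Fin k → Germ n} {x y : Koszul n k 1} :
    koszulD g 0 x = koszulD g 0 y ↔ koszulD g 0 x ⟨∅, Finset.card_empty⟩ =
      koszulD g 0 y ⟨∅, Finset.card_empty⟩ := by
  refine ⟨fun h => by rw [h], fun h => funext fun I => ?_⟩
  have hI : I = ⟨∅, Finset.card_empty⟩ := Subtype.ext (Finset.card_eq_zero.1 I.2)
  rw [hI, h]

/-- The map from degree one of the filtered Koszul complex to `F_μ`. -/
def koszulToF (p : Fin r → Fin n → ℕ) (g : Fin k → Germ n) (μ : Fin r → ℤ) :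
    koszulF p g μ 1 →ₗ[Germ n] F p μ :=
  LinearMap.codRestrict (F p μ)
    ((LinearMap.proj (R := Germ n) (φ := fun _ => Germ n)
      (⟨∅, Finset.card_empty⟩ : {I : Finset (Fin k) // I.card = 0})).comp
        ((koszulD g 0).comp (koszulF p g μ 1).subtype))
    (fun x => relIdeal_le_F p g μ (mem_relIdeal_iff.2 ⟨x.1, x.2, rfl⟩))

theorem koszulToF_apply {p : Fin r → Fin n → ℕ} {g : Fin k → Germ n} {μ : Fin r → ℤ}
    (x : koszulF p g μ 1) :
    (koszulToF p g μ x : Germ n) = koszulD g 0 x.1 ⟨∅, Finset.card_empty⟩ := rfl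

theorem koszulToF_mem_relIdeal {p : Fin r → Fin n → ℕ} {g : Fin k → Germ n} {μ : Fin r → ℤ}
    (x : koszulF p g μ 1) : (koszulToF p g μ x : Germ n) ∈ relIdeal p g μ :=
  mem_relIdeal_iff.2 ⟨x.1, x.2, rfl⟩

theorem transition_mk {p : Fin r → Fin n → ℕ} {g : Fin k → Germ n} {μ : Fin r → ℤ}
    (f : F p (μ + 1)) : transition p g μ (Submodule.Quotient.mk f) =
      Submodule.Quotient.mk ⟨f.1, F_anti p (le_add_of_nonneg_right zero_le_one) f.2⟩ := rfl

/-- Put B(μ) = `relIdeal p g μ`. The cokernel is F_μ/(F_{μ+𝟏} + B(μ)) and the kernel is (B(μ) ∩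
F_{μ+𝟏})/B(μ+𝟏). Both dimensions involve that of B(μ)/(B(μ) ∩ F_{μ+𝟏}), which cancels in the
difference. -/
theorem finrank_transition {p : Fin r → Fin n → ℕ} (hp : ∀ l i, 0 < p l i)
    {g : Fin k → Germ n}
    (hin : ∀ J : Finset (Fin r), CodimGE (fun i => initialPart p J (g i)) J.card)
    (μ : Fin r → ℤ) :
    Module.Finite ℂ (Fbar p g μ ⧸ LinearMap.range (transition p g μ)) ∧
      Module.Finite ℂ (LinearMap.ker (transition p g μ)) ∧
      dimLbar p g μ = dimL p μ - boundaryDim p g μ 0 := by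
  have hfin := (finrank_F_layer hp μ).1
  have hfin0 := (finrank_koszulF_eq_boundaryDim hp hin μ 0).1
  -- The quotient by `N` presents B(μ)/(B(μ) ∩ F_{μ+𝟏}), the term common to both exact sequences.
  let N : Submodule (Germ n) (koszulF p g μ 1) :=
    (Submodule.comap (F p μ).subtype (F p (μ + 1))).comap (koszulToF p g μ)
  have hN : ∀ x, x ∈ N ↔ (koszulToF p g μ x : Germ n) ∈ F p (μ + 1) := fun x => Iff.rfl
  obtain ⟨-, h1, h2⟩ := finrank_of_presentation ℂ (koszulToF p g μ) N.mkQ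
    (Submodule.mkQ (Submodule.comap (F p μ).subtype (F p (μ + 1))))
    ((LinearMap.range (transition p g μ)).mkQ.comp
      (Submodule.mkQ (Submodule.comap (F p μ).subtype (relIdeal p g μ))))
    N.mkQ_surjective (Submodule.mkQ_surjective _)
    ((Submodule.mkQ_surjective _).comp (Submodule.mkQ_surjective _))
    (fun b => by simp only [Submodule.mkQ_apply, Submodule.Quotient.mk_eq_zero]; rfl)
    (fun b => by
      have : Submodule.mkQ (Submodule.comap (F p μ).subtype (relIdeal p g μ))
          (koszulToF p g μ b) = 0 :=
        (Submodule.Quotient.mk_eq_zero _).2 (koszulToF_mem_relIdeal b)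
      rw [LinearMap.comp_apply, this, map_zero])
    (fun a ha => by
      rw [LinearMap.comp_apply, Submodule.mkQ_apply, Submodule.Quotient.mk_eq_zero] at ha
      obtain ⟨y, hy⟩ := ha
      obtain ⟨f, rfl⟩ := Submodule.mkQ_surjective _ y
      rw [Submodule.mkQ_apply, Submodule.mkQ_apply, transition_mk, eq_comm,
        Submodule.Quotient.eq] at hy
      obtain ⟨x, hx, hxa⟩ := mem_relIdeal_iff.1 (Submodule.mem_comap.1 hy)
      refine ⟨⟨x, hx⟩, (Submodule.Quotient.mk_eq_zero _).2 ?_⟩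
      rw [Submodule.mem_comap, Submodule.subtype_apply, Submodule.coe_sub, koszulToF_apply, hxa]
      simp)
    (fun a ha => by
      rw [LinearMap.comp_apply, Submodule.mkQ_apply, Submodule.Quotient.mk_eq_zero]
      rw [Submodule.mkQ_apply, Submodule.Quotient.mk_eq_zero] at ha
      exact ⟨Submodule.Quotient.mk ⟨a.1, ha⟩, rfl⟩)
  let ψ : N →ₗ[Germ n] Fbar p g (μ + 1) := (Submodule.mkQ _).comp
    (LinearMap.codRestrict (F p (μ + 1))
      ((F p μ).subtype.comp ((koszulToF p g μ).comp N.subtype)) fun x => x.2)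
  have hψ : ∀ x : N, ψ x = Submodule.Quotient.mk ⟨(koszulToF p g μ x.1 : Germ n), x.2⟩ :=
    fun _ => rfl
  let π₁ : N →ₗ[Germ n] LinearMap.ker (transition p g μ) := LinearMap.codRestrict _ ψ fun x => by
    rw [LinearMap.mem_ker, hψ, transition_mk, Submodule.Quotient.mk_eq_zero]
    exact koszulToF_mem_relIdeal x.1
  obtain ⟨h3, -, h4⟩ := finrank_of_presentation ℂ N.subtype π₁
    (Submodule.mkQ (boundaryKer p g μ 0)) N.mkQ
    (by
      rintro ⟨y, hy⟩
      obtain ⟨f, rfl⟩ := Submodule.mkQ_surjective _ y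
      rw [LinearMap.mem_ker, Submodule.mkQ_apply, transition_mk,
        Submodule.Quotient.mk_eq_zero] at hy
      obtain ⟨x, hx, hxf⟩ := mem_relIdeal_iff.1 (Submodule.mem_comap.1 hy)
      have hxf : koszulD g 0 x ⟨∅, Finset.card_empty⟩ = f.1 := hxf
      refine ⟨⟨⟨x, hx⟩, (hN _).2 (by rw [koszulToF_apply, hxf]; exact f.2)⟩, Subtype.ext ?_⟩
      refine (hψ _).trans ?_
      exact congrArg _ (Subtype.ext hxf))
    (Submodule.mkQ_surjective _) N.mkQ_surjective
    (fun b => by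
      rw [Submodule.mkQ_apply, Submodule.Quotient.mk_eq_zero, Submodule.subtype_apply,
        mem_boundaryKer, ← Subtype.coe_inj]
      change ψ b = 0 ↔ _
      rw [hψ, Submodule.Quotient.mk_eq_zero, Submodule.mem_comap]
      refine mem_relIdeal_iff.trans ?_
      simp only [koszulD_zero_eq_iff]
      rfl)
    (fun b => by
      rw [Submodule.mkQ_apply, Submodule.Quotient.mk_eq_zero]
      exact b.2)
    (fun a ha => ⟨(⟨a, (Submodule.Quotient.mk_eq_zero _).1 ha⟩ : N), by simp⟩)
    (fun a ha => by
      rw [Submodule.mkQ_apply, Submodule.Quotient.mk_eq_zero] at ha ⊢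
      obtain ⟨y, hy, hya⟩ := mem_boundaryKer.1 ha
      rw [hN, koszulToF_apply, ← hya]
      exact relIdeal_le_F p g _ (mem_relIdeal_iff.2 ⟨y, hy, rfl⟩))
  refine ⟨h1, h3, ?_⟩
  have h2' : dimL p μ = _ := congrArg (Nat.cast (R := ℤ)) h2
  have h4' : boundaryDim p g μ 0 = _ := h4
  rw [h2', h4', dimLbar]
  push_cast
  ring

theorem dimL_eq_card {p : Fin r → Fin n → ℕ} (hp : ∀ l i, 0 < p l i) (μ : Fin r → ℤ) :
    dimL p μ = Nat.card (layer p μ) :=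
  congrArg (Nat.cast (R := ℤ)) (finrank_F_layer hp μ).2

theorem dimLbar_eq_sum {p : Fin r → Fin n → ℕ} (hp : ∀ l i, 0 < p l i)
    {g : Fin k → Germ n}
    (hin : ∀ J : Finset (Fin r), CodimGE (fun i => initialPart p J (g i)) J.card)
    (μ : Fin r → ℤ) :
    dimLbar p g μ = ∑ I : Finset (Fin k), (-1) ^ I.card * dimL p (μ - ∑ i ∈ I, nuZ p (g i)) := by
  classical
  -- The alternating sum telescopes and stops at degree k, where no boundaries remain; `dimL p μ` is
  -- the missing term I = ∅.
  rw [(finrank_transition hp hin μ).2.2, sum_range_boundaryDim hp hin μ k,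
    boundaryDim_eq_zero p g μ le_rfl, Nat.cast_zero, mul_zero, add_zero,
    ← Finset.sum_fiberwise_of_maps_to (s := Finset.univ) (t := Finset.range (k + 1))
      (g := Finset.card) (fun I _ => by
        rw [Finset.mem_range, Nat.lt_succ_iff]
        exact I.card_le_univ.trans_eq (Fintype.card_fin k)),
    Finset.sum_range_succ']
  have hs : ∀ s, ∑ I : Finset (Fin k) with I.card = s,
      (-1) ^ I.card * dimL p (μ - ∑ i ∈ I, nuZ p (g i)) = (-1) ^ s *
      ((∑ I : {I : Finset (Fin k) // I.card = s}, Nat.card (layer p (shift p g μ I.1)) : ℕ) : ℤ) := by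
    intro s
    rw [Finset.sum_subtype (p := fun I => I.card = s) _ (fun I => by simp), Nat.cast_sum,
      Finset.mul_sum]
    refine Finset.sum_congr rfl fun I _ => ?_
    rw [I.2, dimL_eq_card hp, shift]
  simp only [hs]
  rw [← hs 0, show ({I : Finset (Fin k) | I.card = 0} : Finset _) = {∅} by ext; simp]
  simp only [Finset.sum_singleton, Finset.card_empty, pow_zero, one_mul, Finset.sum_empty, sub_zero]
  rw [add_comm, sub_eq_add_neg, ← Finset.sum_neg_distrib]
  congr 1
  refine Finset.sum_congr rfl fun s _ => ?_
  rw [pow_succ]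
  ring

end

section

variable {n r k : ℕ}

/-! ### Power series with exponents in `ℤ^r` -/

theorem coeffZ_sub (P Q : MvPowerSeries (Fin r) ℤ) (μ : Fin r → ℤ) :
    coeffZ (P - Q) μ = coeffZ P μ - coeffZ Q μ := by
  unfold coeffZ
  split_ifs <;> simp

theorem coeffZ_natCast (P : MvPowerSeries (Fin r) ℤ) (m : Fin r →₀ ℕ) :
    coeffZ P (fun l => (m l : ℤ)) = MvPowerSeries.coeff m P := by
  have h : (0 : Fin r → ℤ) ≤ fun l => (m l : ℤ) := fun l => Nat.cast_nonneg _
  rw [coeffZ, if_pos h]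
  congr 2
  ext l
  simp

theorem ext_coeffZ {P Q : MvPowerSeries (Fin r) ℤ} (h : ∀ μ, coeffZ P μ = coeffZ Q μ) :
    P = Q :=
  MvPowerSeries.ext fun m => by rw [← coeffZ_natCast, ← coeffZ_natCast, h]

theorem coeffZ_tpow_mul (m : Fin r → ℕ) (P : MvPowerSeries (Fin r) ℤ) (μ : Fin r → ℤ) :
    coeffZ (tpow m * P) μ = coeffZ P (μ - fun l => (m l : ℤ)) := by
  classical
  unfold coeffZ tpow
  by_cases h : 0 ≤ μ - fun l => (m l : ℤ)
  · have hμ : 0 ≤ μ := fun l => by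
      have := h l
      simp only [Pi.zero_apply, Pi.sub_apply] at this ⊢
      omega
    rw [if_pos hμ, if_pos h, MvPowerSeries.coeff_monomial_mul, if_pos, one_mul]
    · congr 2
      ext l
      have := h l
      simp only [Pi.zero_apply, Pi.sub_apply, Finsupp.tsub_apply,
        Finsupp.coe_equivFunOnFinite_symm] at this ⊢
      omega
    · intro l
      have := h l
      simp only [Pi.zero_apply, Pi.sub_apply, Finsupp.coe_equivFunOnFinite_symm] at this ⊢
      omega
  · rw [if_neg h]
    split_ifs with hμ
    · rw [MvPowerSeries.coeff_monomial_mul, if_neg]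
      intro hle
      apply h
      intro l
      have h1 := hle l
      have h2 := hμ l
      simp only [Pi.zero_apply, Pi.sub_apply, Finsupp.coe_equivFunOnFinite_symm] at h1 h2 ⊢
      omega
    · rfl

theorem coeffZ_prod_one_sub_tpow {ι : Type*} (T : Finset ι) (m : ι → Fin r → ℕ)
    (P : MvPowerSeries (Fin r) ℤ) : ∀ μ : Fin r → ℤ,
    coeffZ ((∏ i ∈ T, (1 - tpow (m i))) * P) μ =
      ∑ I ∈ T.powerset, (-1) ^ I.card * coeffZ P (μ - ∑ i ∈ I, fun l => (m i l : ℤ)) := by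
  classical
  induction T using Finset.induction_on with
  | empty => simp
  | insert a T ha ih =>
    intro μ
    rw [Finset.prod_insert ha, mul_assoc, sub_mul, one_mul, coeffZ_sub, coeffZ_tpow_mul, ih, ih,
      Finset.sum_powerset_insert ha, sub_eq_add_neg, ← Finset.sum_neg_distrib]
    congr 1
    refine Finset.sum_congr rfl fun I hI => ?_
    have haI : a ∉ I := fun h => ha (Finset.mem_powerset.1 hI h)
    rw [Finset.card_insert_of_notMem haI, Finset.sum_insert haI, pow_succ, sub_sub]
    ring

theorem IsPoincareSeries.iff_eq (hr : 0 < r) {L : (Fin r → ℤ) → ℤ}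
    {P : MvPowerSeries (Fin r) ℤ} (hP : IsPoincareSeries L P) (Q : MvPowerSeries (Fin r) ℤ) :
    IsPoincareSeries L Q ↔ Q = P := by
  refine ⟨fun hQ => ?_, fun h => h ▸ hP⟩
  -- Its constant term is -1; for r = 0 the difference would be zero.
  have hne : (tpow 1 - 1 : MvPowerSeries (Fin r) ℤ) ≠ 0 := by
    classical
    intro h
    have h0 := congrArg (MvPowerSeries.coeff (0 : Fin r →₀ ℕ)) h
    rw [map_sub, tpow, MvPowerSeries.coeff_monomial, if_neg] at h0
    · simp at h0
    · intro h1
      have := DFunLike.congr_fun h1 ⟨0, hr⟩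
      simp at this
  refine mul_left_cancel₀ hne (ext_coeffZ fun μ => ?_)
  rw [hQ, hP]

/-! ### The Poincaré series of the filtration by weights -/

/-- The exponents in the variables `T` with weights `μ`. -/
def fibre (p : Fin r → Fin n → ℕ) (T : Finset (Fin n)) (μ : Fin r → ℤ) : Set (Fin n →₀ ℕ) :=
  {q | (∀ l, (pairing (p l) q : ℤ) = μ l) ∧ ∀ i ∉ T, q i = 0}

theorem finite_fibre {p : Fin r → Fin n → ℕ} (hp : ∀ l i, 0 < p l i) (hr : 0 < r)
    (T : Finset (Fin n)) (μ : Fin r → ℤ) : (fibre p T μ).Finite :=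
  (finite_pairing_le (hp ⟨0, hr⟩) (μ ⟨0, hr⟩)).subset fun _ hq => (hq.1 _).le

/-- The generating series of the weights of the monomials in the variables `T`. -/
def weightSeries (p : Fin r → Fin n → ℕ) (T : Finset (Fin n)) : MvPowerSeries (Fin r) ℤ :=
  fun m => ((fibre p T fun l => (m l : ℤ)).ncard : ℤ)

theorem coeffZ_weightSeries (p : Fin r → Fin n → ℕ) (T : Finset (Fin n)) (μ : Fin r → ℤ) :
    coeffZ (weightSeries p T) μ = (fibre p T μ).ncard := by
  unfold coeffZ
  split_ifs with h
  · change ((fibre p T fun l => (((μ l).toNat : ℕ) : ℤ)).ncard : ℤ) = _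
    rw [show (fun l => (((μ l).toNat : ℕ) : ℤ)) = μ from funext fun l => Int.toNat_of_nonneg (h l)]
  · rw [eq_comm, Nat.cast_eq_zero]
    have : fibre p T μ = ∅ := by
      refine Set.eq_empty_of_forall_notMem fun q hq => h fun l => ?_
      rw [← hq.1 l]
      exact Nat.cast_nonneg _
    rw [this, Set.ncard_empty]

theorem weightSeries_empty (p : Fin r → Fin n → ℕ) : weightSeries p ∅ = 1 := by
  classical
  refine MvPowerSeries.ext fun m => ?_
  rw [MvPowerSeries.coeff_one]
  change ((fibre p ∅ fun l => (m l : ℤ)).ncard : ℤ) = _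
  have hq : ∀ q : Fin n →₀ ℕ, (∀ i ∉ (∅ : Finset (Fin n)), q i = 0) ↔ q = 0 := fun q =>
    ⟨fun h => Finsupp.ext fun i => h i (Finset.notMem_empty i), fun h i _ => by rw [h]; rfl⟩
  have h0 : ∀ l, pairing (p l) (0 : Fin n →₀ ℕ) = 0 := fun l => by simp [pairing]
  split_ifs with h
  · have : fibre p ∅ (fun l => (m l : ℤ)) = {0} := by
      ext q
      simp only [fibre, hq, Set.mem_ofPred_eq, Set.mem_singleton_iff]
      refine ⟨fun h => h.2, ?_⟩
      rintro rfl
      exact ⟨fun l => by rw [h0, h]; rfl, rfl⟩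
    rw [this, Set.ncard_singleton, Nat.cast_one]
  · have : fibre p ∅ (fun l => (m l : ℤ)) = ∅ := by
      refine Set.eq_empty_of_forall_notMem fun q hqm => h ?_
      obtain rfl := (hq q).1 hqm.2
      ext l
      have := hqm.1 l
      rw [h0] at this
      exact Nat.cast_injective (R := ℤ) this.symm
    rw [this, Set.ncard_empty, Nat.cast_zero]

theorem pairing_single (v : Fin n → ℕ) (i : Fin n) : pairing v (Finsupp.single i 1) = v i := by
  simp [pairing, Finsupp.single_apply]

/-- A monomial in the variables T ∪ {i} either omits z_i or is z_i times an arbitrary such monomial.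
-/
theorem one_sub_tpow_mul_weightSeries {p : Fin r → Fin n → ℕ} (hp : ∀ l i, 0 < p l i) (hr : 0 < r)
    {T : Finset (Fin n)} {i : Fin n} (hi : i ∉ T) :
    (1 - tpow fun l => p l i) * weightSeries p (insert i T) = weightSeries p T := by
  classical
  refine ext_coeffZ fun μ => ?_
  rw [sub_mul, one_mul, coeffZ_sub, coeffZ_tpow_mul, coeffZ_weightSeries, coeffZ_weightSeries,
    coeffZ_weightSeries]
  have hinj : Function.Injective fun q : Fin n →₀ ℕ => q + Finsupp.single i 1 :=
    add_left_injective _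
  have hunion : fibre p (insert i T) μ = fibre p T μ ∪
      (fun q => q + Finsupp.single i 1) '' fibre p (insert i T) (μ - fun l => (p l i : ℤ)) := by
    ext q
    simp only [Set.mem_union, Set.mem_image, fibre, Set.mem_ofPred_eq, Finset.mem_insert, not_or]
    constructor
    · rintro ⟨h1, h2⟩
      by_cases hq : q i = 0
      · refine Or.inl ⟨h1, fun j hj => ?_⟩
        by_cases hji : j = i
        · rw [hji, hq]
        · exact h2 j ⟨hji, hj⟩
      · have hle : Finsupp.single i 1 ≤ q :=
          Finsupp.single_le_iff.2 (Nat.one_le_iff_ne_zero.2 hq)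
        have hadd := tsub_add_cancel_of_le hle
        refine Or.inr ⟨q - Finsupp.single i 1, ⟨fun l => ?_, fun j hj => ?_⟩, hadd⟩
        · have := h1 l
          rw [← hadd, pairing_add, pairing_single] at this
          rw [Pi.sub_apply]
          push_cast at this
          omega
        · rw [Finsupp.tsub_apply, h2 j hj, zero_tsub]
    · rintro (⟨h1, h2⟩ | ⟨q, ⟨h1, h2⟩, rfl⟩)
      · exact ⟨h1, fun j hj => h2 j hj.2⟩
      · refine ⟨fun l => ?_, fun j hj => ?_⟩
        · have := h1 l
          rw [Pi.sub_apply] at this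
          rw [pairing_add, pairing_single]
          push_cast
          omega
        · rw [Finsupp.add_apply, h2 j hj, Finsupp.single_eq_of_ne hj.1, add_zero]
  have hdisj : Disjoint (fibre p T μ)
      ((fun q => q + Finsupp.single i 1) '' fibre p (insert i T) (μ - fun l => (p l i : ℤ))) := by
    rw [Set.disjoint_left]
    rintro _ ⟨-, h⟩ ⟨q, -, rfl⟩
    have := h i hi
    simp at this
  rw [hunion, Set.ncard_union_eq hdisj (finite_fibre hp hr _ _)
    ((finite_fibre hp hr _ _).image _), Set.ncard_image_of_injective _ hinj]
  push_cast
  ring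

theorem prod_one_sub_tpow_mul_weightSeries {p : Fin r → Fin n → ℕ} (hp : ∀ l i, 0 < p l i)
    (hr : 0 < r) (T : Finset (Fin n)) :
    (∏ i ∈ T, (1 - tpow fun l => p l i)) * weightSeries p T = 1 := by
  classical
  induction T using Finset.induction_on with
  | empty => rw [Finset.prod_empty, one_mul, weightSeries_empty]
  | insert i T hi ih =>
    rw [Finset.prod_insert hi, mul_comm (1 - _), mul_assoc,
      one_sub_tpow_mul_weightSeries hp hr hi, ih]

-- Expansion of ∏_l ([μ_l - 1 ≤ x_l] - [μ_l ≤ x_l]), whose factors are the indicators of x_l = μ_l -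
-- 1.
open Classical in
theorem sum_powerset_indicator (x μ : Fin r → ℤ) :
    ∑ S : Finset (Fin r), (-1 : ℤ) ^ (r - S.card) *
      (if ∀ l, μ l - (if l ∈ S then 1 else 0) ≤ x l then 1 else 0) =
      if ∀ l, x l = μ l - 1 then 1 else 0 := by
  have h := Finset.prod_add (fun l => if μ l - 1 ≤ x l then (1 : ℤ) else 0)
    (fun l => -(if μ l ≤ x l then (1 : ℤ) else 0)) Finset.univ
  have h1 : ∏ l, ((if μ l - 1 ≤ x l then (1 : ℤ) else 0) + -(if μ l ≤ x l then (1 : ℤ) else 0)) =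
      if ∀ l, x l = μ l - 1 then 1 else 0 := by
    have : ∀ l, ((if μ l - 1 ≤ x l then (1 : ℤ) else 0) + -(if μ l ≤ x l then (1 : ℤ) else 0)) =
        if x l = μ l - 1 then 1 else 0 := by
      intro l
      split_ifs <;> omega
    rw [Finset.prod_congr rfl fun l _ => this l, Finset.prod_ite_zero]
    simp
  rw [← h1, h, Finset.powerset_univ]
  refine Finset.sum_congr rfl fun S _ => ?_
  rw [Finset.prod_neg, Finset.prod_ite_zero, Finset.prod_ite_zero, Finset.prod_const_one,
    Finset.prod_const_one, mul_left_comm, ← Finset.compl_eq_univ_sdiff, Finset.card_compl,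
    Fintype.card_fin]
  congr 1
  have hiff : (∀ l, μ l - (if l ∈ S then 1 else 0) ≤ x l) ↔
      (∀ l ∈ S, μ l - 1 ≤ x l) ∧ ∀ l ∈ Sᶜ, μ l ≤ x l := by
    refine ⟨fun h => ⟨fun l hl => by simpa [hl] using h l, fun l hl => ?_⟩, ?_⟩
    · simpa [Finset.mem_compl.1 hl] using h l
    · rintro ⟨h1, h2⟩ l
      by_cases hl : l ∈ S
      · simpa [hl] using h1 l hl
      · simpa [hl] using h2 l (Finset.mem_compl.2 hl)
  rw [if_congr hiff rfl rfl]
  by_cases hS : ∀ l ∈ S, μ l - 1 ≤ x l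
  · rw [if_pos hS, one_mul]
    by_cases hS' : ∀ l ∈ Sᶜ, μ l ≤ x l
    · rw [if_pos hS', if_pos ⟨hS, hS'⟩]
    · rw [if_neg hS', if_neg fun h => hS' h.2]
  · rw [if_neg hS, zero_mul, if_neg fun h => hS h.1]

/-- The indicator of a layer is the difference of the indicators of two orthant conditions on
weights, and the alternating sum turns each of them into the indicator of a single weight. -/
theorem numeratorCoeff_dimL {p : Fin r → Fin n → ℕ} (hp : ∀ l i, 0 < p l i) (hr : 0 < r)
    (μ : Fin r → ℤ) : numeratorCoeff (dimL p) μ =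
      (fibre p Finset.univ (μ - 1)).ncard - (fibre p Finset.univ μ).ncard := by
  classical
  let e : Finset (Fin r) → Fin r → ℤ := fun S l => if l ∈ S then 1 else 0
  -- The orthants may contain infinitely many exponents, so all counting takes place in one finite
  -- set containing every layer and fibre involved.
  have hU : ((⋃ S, layer p (μ - e S)) ∪
      (fibre p Finset.univ (μ - 1) ∪ fibre p Finset.univ μ)).Finite :=
    (Set.finite_iUnion fun S => finite_layer hp _).union
      ((finite_fibre hp hr _ _).union (finite_fibre hp hr _ _))
  set U := hU.toFinset
  have hcard : ∀ A : Set (Fin n →₀ ℕ), A ⊆ U →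
      ((A.ncard : ℕ) : ℤ) = ∑ q ∈ U, if q ∈ A then 1 else 0 := by
    intro A hA
    rw [Finset.sum_boole, Nat.cast_inj, ← Set.ncard_coe_finset, Finset.coe_filter]
    congr 1
    ext q
    exact ⟨fun h => ⟨hA h, h⟩, fun h => h.2⟩
  have hUcoe : (U : Set (Fin n →₀ ℕ)) = _ := hU.coe_toFinset
  have hdim : ∀ S, dimL p (μ - e S) = ∑ q ∈ U,
      ((if ∀ l, μ l - e S l ≤ (pairing (p l) q : ℤ) then 1 else 0) -
        (if ∀ l, (μ + 1 : Fin r → ℤ) l - e S l ≤ (pairing (p l) q : ℤ) then 1 else 0)) := by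
    intro S
    rw [dimL_eq_card hp, Nat.card_coe_set_eq, hcard]
    · refine Finset.sum_congr rfl fun q _ => ?_
      have hiff : q ∈ layer p (μ - e S) ↔ (∀ l, μ l - e S l ≤ (pairing (p l) q : ℤ)) ∧
          ¬ ∀ l, (μ + 1 : Fin r → ℤ) l - e S l ≤ (pairing (p l) q : ℤ) := by
        simp only [layer, upperSet, Set.mem_sdiff, Set.mem_ofPred_eq, Pi.sub_apply, Pi.add_apply,
          Pi.one_apply, sub_add_eq_add_sub]
      rw [if_congr hiff rfl rfl]
      by_cases h2 : ∀ l, (μ + 1 : Fin r → ℤ) l - e S l ≤ (pairing (p l) q : ℤ)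
      · have h1 : ∀ l, μ l - e S l ≤ (pairing (p l) q : ℤ) := fun l => by
          have := h2 l
          simp only [Pi.add_apply, Pi.one_apply] at this
          omega
        rw [if_neg (fun h => h.2 h2), if_pos h1, if_pos h2, sub_self]
      · rw [if_neg h2, sub_zero]
        simp only [h2, not_false_eq_true, and_true]
    · rw [hUcoe]
      exact (Set.subset_iUnion (fun S => layer p (μ - e S)) S).trans Set.subset_union_left
  unfold numeratorCoeff
  change ∑ S, (-1 : ℤ) ^ (r - S.card) * dimL p (μ - e S) = _
  simp only [hdim, Finset.mul_sum, mul_sub]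
  rw [Finset.sum_comm]
  simp only [Finset.sum_sub_distrib]
  rw [hcard (fibre p Finset.univ (μ - 1)) (by
      rw [hUcoe]; exact Set.subset_union_left.trans Set.subset_union_right),
    hcard (fibre p Finset.univ μ) (by
      rw [hUcoe]; exact Set.subset_union_right.trans Set.subset_union_right)]
  congr 1
  · refine Finset.sum_congr rfl fun q _ => ?_
    refine (sum_powerset_indicator (fun l => (pairing (p l) q : ℤ)) μ).trans ?_
    exact if_congr (by simp [fibre]) rfl rfl
  · refine Finset.sum_congr rfl fun q _ => ?_
    refine (sum_powerset_indicator (fun l => (pairing (p l) q : ℤ)) (μ + 1)).trans ?_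
    exact if_congr (by simp [fibre]) rfl rfl

theorem isPoincareSeries_dimL {p : Fin r → Fin n → ℕ} (hp : ∀ l i, 0 < p l i) (hr : 0 < r) :
    IsPoincareSeries (dimL p) (weightSeries p Finset.univ) := by
  intro μ
  rw [sub_mul, one_mul, coeffZ_sub, coeffZ_tpow_mul, numeratorCoeff_dimL hp hr,
    coeffZ_weightSeries, coeffZ_weightSeries]
  have : (μ - fun l => (((1 : Fin r → ℕ) l : ℕ) : ℤ)) = μ - 1 := by
    ext l
    simp
  rw [this]

theorem isPoincareSeries_dimLbar {p : Fin r → Fin n → ℕ} (hp : ∀ l i, 0 < p l i) {g : Fin k → Germ n}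
    (hin : ∀ J : Finset (Fin r), CodimGE (fun i => initialPart p J (g i)) J.card)
    {P : MvPowerSeries (Fin r) ℤ} (hP : IsPoincareSeries (dimL p) P) :
    IsPoincareSeries (dimLbar p g) ((∏ i, (1 - tpow (nu p (g i)))) * P) := by
  intro μ
  rw [mul_left_comm, coeffZ_prod_one_sub_tpow, Finset.powerset_univ]
  simp only [hP _, numeratorCoeff, dimLbar_eq_sum hp hin, Finset.mul_sum]
  rw [Finset.sum_comm]
  refine Finset.sum_congr rfl fun S _ => Finset.sum_congr rfl fun I _ => ?_
  rw [mul_left_comm]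
  congr 3
  exact sub_right_comm _ _ _

/-! ### Positivity of the normals -/

theorem add_mem_newtonPolyhedron {f : Germ n} {x v : Fin n → ℝ} (hx : x ∈ newtonPolyhedron f)
    (hv : 0 ≤ v) : x + v ∈ newtonPolyhedron f := by
  refine convexHull_min ?_ ((convex_convexHull ℝ _).translate_preimage_left v) hx
  rintro y ⟨q, hq, hqy⟩
  exact subset_convexHull ℝ _ ⟨q, hq, fun i => (hqy i).trans (le_add_of_nonneg_right (hv i))⟩

/-- If v_i = 0, the face contains a ray in the direction of the i-th axis and is unbounded. -/
theorem IsCompactFacetNormal.pos {f : Germ n} {v : Fin n → ℕ}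
    (h : IsCompactFacetNormal (newtonPolyhedron f) v) (i : Fin n) : 0 < v i := by
  classical
  obtain ⟨-, ⟨x, hx⟩, hcomp, -⟩ := h
  by_contra hvi
  have hvi : v i = 0 := by omega
  have hmem : ∀ t : ℝ, 0 ≤ t → x + Pi.single i t ∈ face (newtonPolyhedron f) v := by
    intro t ht
    refine ⟨add_mem_newtonPolyhedron hx.1 (Pi.single_nonneg.2 ht), fun y hy => ?_⟩
    refine le_trans (le_of_eq (Finset.sum_congr rfl fun j _ => ?_)) (hx.2 y hy)
    by_cases hj : j = i
    · simp [hj, hvi]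
    · simp [hj]
  obtain ⟨C, hC⟩ := (hcomp.image (continuous_apply i)).bddAbove
  have h1 := hC ⟨_, hmem (|C| + |x i| + 1) (by positivity), rfl⟩
  simp only [Pi.add_apply, Pi.single_eq_same] at h1
  have h2 := le_abs_self C
  have h3 := neg_abs_le (x i)
  linarith

end

end NewtonFiltration

end

/-! ### The theorem -/

open NewtonFiltration in
theorem lemma1p3 {n k r : ℕ} (hr : 0 < r) (g : Fin k → Germ n)
    (hci : IsCompleteIntersection g)
    (hconv : ∀ i, IsConvenient (g i))
    (p : Fin r → Fin n → ℕ) (hpinj : Function.Injective p)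
    (hp : ∀ v : Fin n → ℕ,
      v ∈ Set.range p ↔ IsCompactFacetNormal (newtonPolyhedron (∏ i, g i)) v)
    (hin : ∀ J : Finset (Fin r), J.Nonempty →
      CodimGE (fun i => initialPart p J (g i)) J.card) :
    -- the Koszul complex induces an exact sequence of the filtered pieces, for every `μ`
    (∀ μ : Fin r → ℤ,
      ∃ hmaps : ∀ s : ℕ, ∀ x ∈ koszulF p g μ (s + 1), koszulD g s x ∈ koszulF p g μ s,
        (∀ s : ℕ, s + 1 = k → Function.Injective ((koszulD g s).restrict (hmaps s))) ∧
        (∀ s : ℕ, Function.Exact ((koszulD g (s + 1)).restrict (hmaps (s + 1)))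
          ((koszulD g s).restrict (hmaps s))) ∧
        Function.Exact ((koszulD g 0).restrict (hmaps 0)) (augmentation p g μ) ∧
        Function.Surjective (augmentation p g μ)) ∧
    -- the dimensions that enter the series `L` are finite
    (∀ μ : Fin r → ℤ,
      Module.Finite ℂ (F p μ ⧸ Submodule.comap (F p μ).subtype (F p (μ + 1))) ∧
      Module.Finite ℂ (Fbar p g μ ⧸ LinearMap.range (transition p g μ)) ∧
      Module.Finite ℂ (LinearMap.ker (transition p g μ))) ∧
    -- the Poincaré series exist, are unique, and satisfy the product formula
    ∃ P : MvPowerSeries (Fin r) ℤ,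
      (∏ l : Fin n, (1 - tpow fun j => p j l)) * P = 1 ∧
      (∀ Q, IsPoincareSeries (dimL p) Q ↔ Q = P) ∧
      (∀ Q, IsPoincareSeries (dimLbar p g) Q ↔ Q = (∏ i, (1 - tpow (nu p (g i)))) * P) := by
  have hpos : ∀ l i, 0 < p l i := fun l => ((hp (p l)).1 ⟨l, rfl⟩).pos
  have hin' := codimGE_initialPart hci hin
  refine ⟨fun μ => ⟨koszulD_mem_koszulF p g μ, ?_, ?_, ?_, augmentation_surjective p g μ⟩,
    fun μ => ⟨(finrank_F_layer hpos μ).1, (finrank_transition hpos hin' μ).1,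
      (finrank_transition hpos hin' μ).2.1⟩, weightSeries p Finset.univ,
    prod_one_sub_tpow_mul_weightSeries hpos hr Finset.univ,
    (isPoincareSeries_dimL hpos hr).iff_eq hr,
    (isPoincareSeries_dimLbar hpos hin' (isPoincareSeries_dimL hpos hr)).iff_eq hr⟩
  · rintro s rfl
    rw [← LinearMap.ker_eq_bot, LinearMap.ker_eq_bot']
    rintro ⟨x, hx⟩ hdx
    obtain ⟨y, -, rfl⟩ := exists_koszulF_primitive hin' μ s x hx (congrArg Subtype.val hdx)
    -- There are no index sets with k + 1 elements, so exactness in degree k is injectivity.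
    have hy : y = 0 := by
      ext1 I
      have := I.1.card_le_univ
      rw [I.2, Fintype.card_fin] at this
      omega
    simp [hy]
  · intro s
    rintro ⟨x, hx⟩
    constructor
    · intro hdx
      obtain ⟨y, hy, hyx⟩ := exists_koszulF_primitive hin' μ s x hx (congrArg Subtype.val hdx)
      exact ⟨⟨y, hy⟩, Subtype.ext hyx⟩
    · rintro ⟨y, hy⟩
      rw [← hy]
      exact Subtype.ext (koszulD_koszulD g s y.1)
  · intro x
    rw [augmentation_eq_zero_iff, mem_relIdeal_iff]
    constructor
    · rintro ⟨y, hy, hyx⟩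
      refine ⟨⟨y, hy⟩, Subtype.ext (funext fun I => ?_)⟩
      have hI : I = ⟨∅, Finset.card_empty⟩ := Subtype.ext (Finset.card_eq_zero.1 I.2)
      rw [hI]
      exact hyx
    · rintro ⟨y, rfl⟩
      exact ⟨y.1, y.2, rfl⟩
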